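/- **Setting.** Sequences are elements of $\{0,1\}^{\mathbb N}$, $\mathbb N=\{1,2,\dots\}$, ordered lexicographically ($\prec,\preceq$), and $\sigma^n(c_1c_2\cdots)=c_{n+1}c_{n+2}\cdots$. A sequence is *infinite* if it does not end with $10^\infty$, and *co-infinite* if it does not end with $01^\infty$. Let $\mathcal A=\{(q_0,q_1)\in(1,\infty)^2: q_0+q_1\ge q_0q_1\}$ and $\mathcal C=\{(q_0,q_1)\in(1,\infty)^2: q_0+q_1=q_0q_1\}$. For $Q=(q_0,q_1)\in\mathcal A$ put $J_Q=[0,\tfrac1{q_1-1}]$ and $\pi_Q(c)=\sum_{k\ge1}\frac{c_k}{q_{c_1}\cdots q_{c_k}}$; a sequence $c$ is an expansion of $x$ if $\pi_Q(c)=x$. For $x\in J_Q$ let $a(x)$ be the largest infinite expansion of $x$ and $m(x)$ its smallest co-infinite expansion. Let $\alpha=\alpha(Q)=a(q_0/q_1)$ and $\mu=\mu(Q)=m\bigl(\tfrac{q_1}{q_0(q_1-1)}-1\bigr)$. $\mathcal U_Q$ is the set of $x\in J_Q$ having an expansion $c$ with $\sigma^j(c)\prec\alpha$ whenever $c_j=0$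 and $\sigma^j(c)\succ\mu$ whenever $c_j=1$. $\mathcal V_Q$ is the set of $x\in J_Q$ with $\sigma^j(m(x))\preceq\alpha$ whenever $m_j(x)=0$ and $\sigma^j(a(x))\succeq\mu$ whenever $a_j(x)=1$. $\overline{\mathcal U}_Q$ is the closure of $\mathcal U_Q$ in $\mathbb R$. A *Cantor set* is a non-empty compact set of reals with neither isolated nor interior points. A set is *discrete* if all its points are isolated in it. **Cases.** All conditions are for all $i,j\in\mathbb N$, and in cases 1–9 each sign $\preceq$ means that the weak inequality holds for all indices, with equality for at least one index in $\mathbb N$. 1. $\mu\prec\sigma^i(\mu)\prec\alpha$ and $\mu\prec\sigma^j(\alpha)\prec\alpha$; 2. $\mu\prec\sigma^i(\mu)\prec\alpha$ and $\mu\preceq\sigma^j(\alpha)\prec\alpha$; 3. $\mu\prec\sigma^i(\mu)\preceq\alpha$ and $\mu\prec\sigma^j(\alpha)\prec\alpha$; 4. $\mu\prec\sigma^i(\mu)\prec\alpha$ and $\mu\prec\sigma^j(\alpha)\preceq\alpha$; 5. $\mu\preceq\sigma^i(\mu)\prec\alpha$ and $\mu\prec\sigma^j(\alpha)\prec\alpha$;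 6. $\mu\prec\sigma^i(\mu)\preceq\alpha$ and $\mu\prec\sigma^j(\alpha)\preceq\alpha$; 7. $\mu\preceq\sigma^i(\mu)\prec\alpha$ and $\mu\preceq\sigma^j(\alpha)\prec\alpha$; 8. $\mu\preceq\sigma^i(\mu)\prec\alpha$ and $\mu\prec\sigma^j(\alpha)\preceq\alpha$; 9. $\mu\preceq\sigma^i(\mu)\preceq\alpha$ and $\mu\preceq\sigma^j(\alpha)\preceq\alpha$; 10. $\mu_i=0$ and $\sigma^i(\mu)\succ\alpha$ for at least one $i\in\mathbb N$, and $\mu\prec\sigma^j(\alpha)$ for all $j\in\mathbb N$; 11. $\sigma^i(\mu)\prec\alpha$ for all $i\in\mathbb N$, and $\alpha_j=1$ and $\mu\succ\sigma^j(\alpha)$ for at least one $j\in\mathbb N$; 12. there exist $i,j\in\mathbb N$ with $\mu_i=0$, $\sigma^i(\mu)\succ\alpha$, $\alpha_j=1$ and $\mu\succ\sigma^j(\alpha)$. **Theorem.** Let $Q\in\mathcal A$. (i) $\mathcal V_Q$ is closed, and $\mathcal U_Q\subseteq\overline{\mathcal U}_Q\subseteq\mathcal V_Q$. (ii) In each of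 cases 1–11, $|\mathcal V_Q\setminus\mathcal U_Q|=\aleph_0$, and $\mathcal V_Q\setminus\mathcal U_Q$ is dense in $\mathcal V_Q$. (iii) In case 9, $\mathcal U_Q$ is closed, $\mathcal V_Q\setminus\mathcal U_Q$ is discrete, and $\mathcal V_Q$ is not a Cantor set. (iv) If $Q\in\mathcal C$, then $\overline{\mathcal U}_Q=\mathcal V_Q=J_Q$. (v) In cases 1, 4, 5, and in case 8 if $Q\notin\mathcal C$, we have $\mathcal U_Q\subsetneq\overline{\mathcal U}_Q=\mathcal V_Q$, and $\mathcal V_Q$ is a Cantor set. (vi) In cases 2, 3, 6, 7, $\overline{\mathcal U}_Q\subsetneq\mathcal V_Q$, and $\mathcal V_Q$ is not a Cantor set. Furthermore, $\mathcal V_Q\setminus\overline{\mathcal U}_Q$ is discrete if and only if $\mathcal U_Q$ is **not** closed; and $\mathcal U_Q$ is closed if and only if $\frac1{q_0(q_1-1)}\notin\overline{\mathcal U}_Q$ (cases 2 and 7), respectively $\frac1{q_1}\notin\overline{\mathcal U}_Q$ (cases 3 and 6). (vii) In cases 10 and 11, $\mathcal U_Q\subsetneq\mathcal V_Q$, and $\mathcal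 U_Q$ is closed if and only if $\frac1{q_0(q_1-1)}\notin\overline{\mathcal U}_Q$ (case 11), respectively $\frac1{q_1}\notin\overline{\mathcal U}_Q$ (case 10). Furthermore, $\mathcal V_Q\setminus\mathcal U_Q$ is a non-empty discrete set if $\mathcal U_Q$ is closed, and $\overline{\mathcal U}_Q=\mathcal V_Q$ otherwise. (viii) In case 12, $\mathcal U_Q=\overline{\mathcal U}_Q=\mathcal V_Q$. -/

import Mathlib

namespace DoubleBase

/-! ### Binary sequences

Sequences `c₁c₂⋯` of digits in `{0, 1}` are functions `c : ℕ → Fin 2`; the digit `cⱼ` with `j ≥ 1`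
is `c (j - 1)`.  The lexicographic order is Mathlib's order on `Lex (ℕ → Fin 2)`. -/

/-- `shift n c = cₙ₊₁cₙ₊₂⋯`. -/
def shift (n : ℕ) (c : ℕ → Fin 2) : ℕ → Fin 2 := fun k => c (n + k)

/-- `c` ends with `10^∞`. -/
def IsFinite (c : ℕ → Fin 2) : Prop := ∃ n, c n = 1 ∧ ∀ k, n < k → c k = 0

/-- `c` ends with `01^∞`. -/
def IsCofinite (c : ℕ → Fin 2) : Prop := ∃ n, c n = 0 ∧ ∀ k, n < k → c k = 1

/-! ### Expansions in a double-base `Q = (q₀, q₁)` -/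

/-- The base `q_d` attached to the digit `d`. -/
def base (Q : ℝ × ℝ) (d : Fin 2) : ℝ := if d = 0 then Q.1 else Q.2

/-- `π_Q(c) = ∑_{k ≥ 1} c_k / (q_{c₁} ⋯ q_{c_k})`. -/
noncomputable def value (Q : ℝ × ℝ) (c : ℕ → Fin 2) : ℝ :=
  ∑' k, ((c k : ℕ) : ℝ) / ∏ i ∈ Finset.range (k + 1), base Q (c i)

/-- The set `𝒜` of double-bases. -/
def admissible : Set (ℝ × ℝ) := {Q | 1 < Q.1 ∧ 1 < Q.2 ∧ Q.1 * Q.2 ≤ Q.1 + Q.2}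

/-- The curve `𝒞`. -/
def curve : Set (ℝ × ℝ) := {Q | 1 < Q.1 ∧ 1 < Q.2 ∧ Q.1 + Q.2 = Q.1 * Q.2}

/-- The interval `J_Q = [0, 1/(q₁ - 1)]`. -/
def interval (Q : ℝ × ℝ) : Set ℝ := Set.Icc 0 (1 / (Q.2 - 1))

/-- `c` is the lexicographically largest expansion of `x` that does not end with `10^∞`. -/
def IsQuasiGreedy (Q : ℝ × ℝ) (x : ℝ) (c : ℕ → Fin 2) : Prop :=
  (¬ IsFinite c ∧ value Q c = x) ∧
    ∀ d : ℕ → Fin 2, ¬ IsFinite d → value Q d = x → toLex d ≤ toLex c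

/-- `c` is the lexicographically smallest expansion of `x` that does not end with `01^∞`. -/
def IsQuasiLazy (Q : ℝ × ℝ) (x : ℝ) (c : ℕ → Fin 2) : Prop :=
  (¬ IsCofinite c ∧ value Q c = x) ∧
    ∀ d : ℕ → Fin 2, ¬ IsCofinite d → value Q d = x → toLex c ≤ toLex d

/-- The quasi-greedy expansion `a(x, Q)`; it is unique by antisymmetry, and it exists for
`Q ∈ 𝒜` and `x ∈ J_Q`. -/
noncomputable def quasiGreedy (Q : ℝ × ℝ) (x : ℝ) : ℕ → Fin 2 :=
  Classical.epsilon (IsQuasiGreedy Q x)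

/-- The quasi-lazy expansion `m(x, Q)`; it is unique by antisymmetry, and it exists for
`Q ∈ 𝒜` and `x ∈ J_Q`. -/
noncomputable def quasiLazy (Q : ℝ × ℝ) (x : ℝ) : ℕ → Fin 2 :=
  Classical.epsilon (IsQuasiLazy Q x)

/-- `α(Q)`, the quasi-greedy expansion of `r_Q = q₀/q₁`. -/
noncomputable def alpha (Q : ℝ × ℝ) : ℕ → Fin 2 := quasiGreedy Q (Q.1 / Q.2)

/-- `μ(Q)`, the quasi-lazy expansion of `ℓ_Q = q₁/(q₀(q₁ - 1)) - 1`. -/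
noncomputable def mu (Q : ℝ × ℝ) : ℕ → Fin 2 := quasiLazy Q (Q.2 / (Q.1 * (Q.2 - 1)) - 1)

/-- The set `𝒰_Q`: the `x ∈ J_Q` with an expansion `c` such that `σʲ(c) ≺ α(Q)` whenever `cⱼ = 0`
and `σʲ(c) ≻ μ(Q)` whenever `cⱼ = 1`. -/
def univoque (Q : ℝ × ℝ) : Set ℝ :=
  {x | x ∈ interval Q ∧ ∃ c : ℕ → Fin 2, value Q c = x ∧
    (∀ j, c j = 0 → toLex (shift (j + 1) c) < toLex (alpha Q)) ∧
    (∀ j, c j = 1 → toLex (mu Q) < toLex (shift (j + 1) c))}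

/-- The set `𝒱_Q`: the `x ∈ J_Q` with `σʲ(m(x)) ≼ α(Q)` whenever `mⱼ(x) = 0`
and `σʲ(a(x)) ≽ μ(Q)` whenever `aⱼ(x) = 1`. -/
def weakUnivoque (Q : ℝ × ℝ) : Set ℝ :=
  {x | x ∈ interval Q ∧
    (∀ j, quasiLazy Q x j = 0 → toLex (shift (j + 1) (quasiLazy Q x)) ≤ toLex (alpha Q)) ∧
    (∀ j, quasiGreedy Q x j = 1 → toLex (mu Q) ≤ toLex (shift (j + 1) (quasiGreedy Q x)))}

/-! ### The twelve cases -/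

/-- `c ≺ σⁱ(w)` for all `i ≥ 1`. -/
def LtShifts (c w : ℕ → Fin 2) : Prop := ∀ i, 1 ≤ i → toLex c < toLex (shift i w)

/-- `c ≼ σⁱ(w)` for all `i ≥ 1`, with equality for at least one `i ≥ 1`. -/
def LeShifts (c w : ℕ → Fin 2) : Prop :=
  (∀ i, 1 ≤ i → toLex c ≤ toLex (shift i w)) ∧ ∃ i, 1 ≤ i ∧ c = shift i w

/-- `σⁱ(w) ≺ c` for all `i ≥ 1`. -/
def ShiftsLt (w c : ℕ → Fin 2) : Prop := ∀ i, 1 ≤ i → toLex (shift i w) < toLex c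

/-- `σⁱ(w) ≼ c` for all `i ≥ 1`, with equality for at least one `i ≥ 1`. -/
def ShiftsLe (w c : ℕ → Fin 2) : Prop :=
  (∀ i, 1 ≤ i → toLex (shift i w) ≤ toLex c) ∧ ∃ i, 1 ≤ i ∧ shift i w = c

def Case1 (μ α : ℕ → Fin 2) : Prop :=
  LtShifts μ μ ∧ ShiftsLt μ α ∧ LtShifts μ α ∧ ShiftsLt α α

def Case2 (μ α : ℕ → Fin 2) : Prop :=
  LtShifts μ μ ∧ ShiftsLt μ α ∧ LeShifts μ α ∧ ShiftsLt α α

def Case3 (μ α : ℕ → Fin 2) : Prop :=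
  LtShifts μ μ ∧ ShiftsLe μ α ∧ LtShifts μ α ∧ ShiftsLt α α

def Case4 (μ α : ℕ → Fin 2) : Prop :=
  LtShifts μ μ ∧ ShiftsLt μ α ∧ LtShifts μ α ∧ ShiftsLe α α

def Case5 (μ α : ℕ → Fin 2) : Prop :=
  LeShifts μ μ ∧ ShiftsLt μ α ∧ LtShifts μ α ∧ ShiftsLt α α

def Case6 (μ α : ℕ → Fin 2) : Prop :=
  LtShifts μ μ ∧ ShiftsLe μ α ∧ LtShifts μ α ∧ ShiftsLe α α

def Case7 (μ α : ℕ → Fin 2) : Prop :=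
  LeShifts μ μ ∧ ShiftsLt μ α ∧ LeShifts μ α ∧ ShiftsLt α α

def Case8 (μ α : ℕ → Fin 2) : Prop :=
  LeShifts μ μ ∧ ShiftsLt μ α ∧ LtShifts μ α ∧ ShiftsLe α α

def Case9 (μ α : ℕ → Fin 2) : Prop :=
  LeShifts μ μ ∧ ShiftsLe μ α ∧ LeShifts μ α ∧ ShiftsLe α α

/-- `μᵢ = 0` and `σⁱ(μ) ≻ α` for some `i ≥ 1`; here `i` is written `i + 1` with `i : ℕ`. -/
def ExceedsAlpha (μ α : ℕ → Fin 2) : Prop :=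
  ∃ i, μ i = 0 ∧ toLex α < toLex (shift (i + 1) μ)

/-- `αⱼ = 1` and `μ ≻ σʲ(α)` for some `j ≥ 1`; here `j` is written `j + 1` with `j : ℕ`. -/
def FallsBelowMu (μ α : ℕ → Fin 2) : Prop :=
  ∃ j, α j = 1 ∧ toLex (shift (j + 1) α) < toLex μ

def Case10 (μ α : ℕ → Fin 2) : Prop := ExceedsAlpha μ α ∧ LtShifts μ α

def Case11 (μ α : ℕ → Fin 2) : Prop := ShiftsLt μ α ∧ FallsBelowMu μ α

def Case12 (μ α : ℕ → Fin 2) : Prop := ExceedsAlpha μ α ∧ FallsBelowMu μ α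

/-! ### Topology -/

/-- A Cantor set: a non-empty compact set of reals with neither isolated nor interior points. -/
def IsCantorSet (S : Set ℝ) : Prop :=
  S.Nonempty ∧ IsCompact S ∧ (∀ x ∈ S, AccPt x (Filter.principal S)) ∧ interior S = ∅

end DoubleBase

namespace DoubleBase

/-! Write L = 1/q₀'s opposite endpoint in the usual order: L = 1/q₁ and R = 1/(q₀(q₁ - 1)), so that
[L, R] is the set of x in J_Q at which both digits are possible. Let T be the quasi-greedy map, q₀x
for x ≤ L and q₁x - 1 for x > L. Then 0α is the quasi-greedy itinerary of L and 1μ is the quasi-lazy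
itinerary of R. Both branches are expanding, so a violated inequality between values would grow
along the orbit without bound; hence the lexicographic conditions are conditions on orbits.
`weakUnivoque_eq` and `univoque_eq` say that 𝒱 consists of the points whose T-orbit avoids the open
hole (L, R), and 𝒰 of those whose orbit avoids [L, R]. Consequently 𝒱 \ 𝒰 is the countable set of
points of 𝒱 whose orbit meets L or R.

The twelve cases only record which of L, R survive, that is, lie in 𝒱, and which of them hits the
other under T: α falling below μ means that L does not survive, a shift of α equal to μ means that L
hits R, and symmetrically for R.

Suppose L < R. Intervals expand until they meet the hole, so 𝒱 has no interior. A gap of 𝒱 is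
carried by T onto a gap until it reaches the hole; therefore its right endpoint hits R if R
survives, and its left endpoint hits L if L survives. So if an endpoint survives, every point of 𝒱
that does not hit it is a limit of points of 𝒱 that do (`accPt_hits`), which gives density.
Conversely a point of 𝒱 hitting R is isolated from the left and one hitting L from the right, so a
point hitting both is isolated (`not_accPt_of_hits`).

If both endpoints survive and neither hits the other, no point hits both, so 𝒱 is perfect, and 𝒰 is
dense in it because the complement is countable. If they hit each other, all of 𝒱 \ 𝒰 is isolated.
If only one endpoint hits the other, or only one survives, local invertibility of T on 𝒱 transfers
accumulation between a single endpoint and its preimages. If none survives, 𝒰 = 𝒱. On 𝒞 the hole is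
empty and 𝒱 = J_Q. -/

variable {Q : ℝ × ℝ}

/-! ### The switch region -/

/-- The left endpoint `1 / q₁` of the switch region. -/
noncomputable def switchLeft (Q : ℝ × ℝ) : ℝ := 1 / Q.2

/-- The right endpoint `1 / (q₀ (q₁ - 1))` of the switch region. -/
noncomputable def switchRight (Q : ℝ × ℝ) : ℝ := 1 / (Q.1 * (Q.2 - 1))

/-- The right endpoint of `J_Q`. -/
noncomputable def top (Q : ℝ × ℝ) : ℝ := 1 / (Q.2 - 1)

lemma snd_mul_switchLeft (hQ : Q ∈ admissible) : Q.2 * switchLeft Q = 1 := by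
  have := hQ.2.1
  unfold switchLeft
  field_simp

lemma fst_mul_switchRight (hQ : Q ∈ admissible) : Q.1 * switchRight Q = top Q := by
  have h0 := hQ.1
  have h1 : 0 < Q.2 - 1 := by linarith [hQ.2.1]
  unfold switchRight top
  field_simp

lemma snd_mul_top (hQ : Q ∈ admissible) : Q.2 * top Q = top Q + 1 := by
  have h1 : 0 < Q.2 - 1 := by linarith [hQ.2.1]
  unfold top
  field_simp
  ring

lemma top_pos (hQ : Q ∈ admissible) : 0 < top Q := by
  have h1 : 0 < Q.2 - 1 := by linarith [hQ.2.1]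
  unfold top
  positivity

lemma switchLeft_pos (hQ : Q ∈ admissible) : 0 < switchLeft Q := by
  have := hQ.2.1
  unfold switchLeft
  positivity

/-- After taking reciprocals this is the inequality q₀q₁ ≤ q₀ + q₁ that defines 𝒜, with equality
exactly on 𝒞. -/
lemma switchLeft_le_switchRight (hQ : Q ∈ admissible) : switchLeft Q ≤ switchRight Q := by
  obtain ⟨h0, h1, h2⟩ := hQ
  have : 0 < Q.1 * (Q.2 - 1) := mul_pos (by linarith) (by linarith)
  exact one_div_le_one_div_of_le this (by linarith)

lemma switchLeft_lt_switchRight (hQ : Q ∈ admissible) (hC : Q ∉ curve) :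
    switchLeft Q < switchRight Q := by
  obtain ⟨h0, h1, h2⟩ := hQ
  have : 0 < Q.1 * (Q.2 - 1) := mul_pos (by linarith) (by linarith)
  refine one_div_lt_one_div_of_lt this ?_
  have : Q.1 * Q.2 ≠ Q.1 + Q.2 := fun h => hC ⟨h0, h1, h.symm⟩
  have := lt_of_le_of_ne h2 this
  linarith

lemma switchLeft_eq_switchRight (hC : Q ∈ curve) :
    switchLeft Q = switchRight Q := by
  unfold switchLeft switchRight
  rw [mul_sub, ← hC.2.2]
  ring

lemma switchRight_lt_top (hQ : Q ∈ admissible) : switchRight Q < top Q := by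
  have h := fst_mul_switchRight hQ
  have h1 := top_pos hQ
  have h2 := hQ.1
  have h3 : 0 < switchRight Q := (switchLeft_pos hQ).trans_le (switchLeft_le_switchRight hQ)
  nlinarith

/-! ### The value of a sequence -/

/-- The map `x ↦ q₀ x` or `x ↦ q₁ x - 1` that removes the digit `d` from an expansion of `x`. -/
noncomputable def branch (Q : ℝ × ℝ) (d : Fin 2) (x : ℝ) : ℝ :=
  if d = 0 then Q.1 * x else Q.2 * x - 1

lemma fin_two (d : Fin 2) : d = 0 ∨ d = 1 := by fin_cases d <;> simp

lemma branch_zero (x : ℝ) : branch Q 0 x = Q.1 * x := by simp [branch]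

lemma branch_one (x : ℝ) : branch Q 1 x = Q.2 * x - 1 := by simp [branch]

lemma shift_apply (n k : ℕ) (c : ℕ → Fin 2) : shift n c k = c (n + k) := rfl

lemma shift_zero (c : ℕ → Fin 2) : shift 0 c = c := by ext k; simp [shift]

lemma shift_shift (m n : ℕ) (c : ℕ → Fin 2) : shift m (shift n c) = shift (n + m) c := by
  ext k; simp [shift, add_assoc]

/-- The terms of the series that defines `value`. -/
noncomputable def valueTerm (Q : ℝ × ℝ) (c : ℕ → Fin 2) (k : ℕ) : ℝ :=
  ((c k : ℕ) : ℝ) / ∏ i ∈ Finset.range (k + 1), base Q (c i)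

lemma base_pos (hQ : Q ∈ admissible) (d : Fin 2) : 0 < base Q d := by
  unfold base
  split_ifs <;> linarith [hQ.1, hQ.2.1]

lemma valueTerm_nonneg (hQ : Q ∈ admissible) (c : ℕ → Fin 2) (k : ℕ) : 0 ≤ valueTerm Q c k :=
  div_nonneg (Nat.cast_nonneg _) (Finset.prod_nonneg fun _ _ => (base_pos hQ _).le)

lemma valueTerm_succ (c : ℕ → Fin 2) (k : ℕ) :
    valueTerm Q c (k + 1) = valueTerm Q (shift 1 c) k / base Q (c 0) := by
  unfold valueTerm
  rw [Finset.prod_range_succ', div_div]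
  simp [shift, add_comm 1]

/-- Prepending a digit turns a bound t for the tail into t/q₀ or (t + 1)/q₁. The number `top Q` is
fixed by the second map and decreased by the first. -/
lemma sum_valueTerm_le (hQ : Q ∈ admissible) (n : ℕ) (c : ℕ → Fin 2) :
    ∑ k ∈ Finset.range n, valueTerm Q c k ≤ top Q := by
  have hp := hQ.1
  have hq := hQ.2.1
  have ht := top_pos hQ
  have hqt := snd_mul_top hQ
  induction n generalizing c with
  | zero => simpa using ht.le
  | succ n ih =>
    rw [Finset.sum_range_succ']
    simp only [valueTerm_succ]
    rw [← Finset.sum_div]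
    have h := ih (shift 1 c)
    rcases fin_two (c 0) with hc | hc
    · have h2 : (∑ i ∈ Finset.range n, valueTerm Q (shift 1 c) i) / Q.1 ≤ top Q := by
        rw [div_le_iff₀ (by linarith)]
        nlinarith
      simpa [valueTerm, base, hc] using h2
    · have h2 : (∑ i ∈ Finset.range n, valueTerm Q (shift 1 c) i) / Q.2 + 1 / Q.2 ≤ top Q := by
        rw [← add_div, div_le_iff₀ (by linarith)]
        nlinarith
      simpa [valueTerm, base, hc] using h2

lemma summable_valueTerm (hQ : Q ∈ admissible) (c : ℕ → Fin 2) : Summable (valueTerm Q c) :=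
  summable_of_sum_range_le (valueTerm_nonneg hQ c) fun n => sum_valueTerm_le hQ n c

lemma value_nonneg (hQ : Q ∈ admissible) (c : ℕ → Fin 2) : 0 ≤ value Q c :=
  tsum_nonneg (valueTerm_nonneg hQ c)

lemma value_le_top (hQ : Q ∈ admissible) (c : ℕ → Fin 2) : value Q c ≤ top Q :=
  Real.tsum_le_of_sum_range_le (valueTerm_nonneg hQ c) fun n => sum_valueTerm_le hQ n c

lemma value_shift_one (hQ : Q ∈ admissible) (c : ℕ → Fin 2) :
    value Q (shift 1 c) = branch Q (c 0) (value Q c) := by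
  have hp := hQ.1
  have hq := hQ.2.1
  have h : value Q c = valueTerm Q c 0 + value Q (shift 1 c) / base Q (c 0) := by
    change ∑' k, valueTerm Q c k = _ + (∑' k, valueTerm Q (shift 1 c) k) / _
    rw [(summable_valueTerm hQ c).tsum_eq_zero_add, ← tsum_div_const]
    simp only [valueTerm_succ]
  rw [h]
  rcases fin_two (c 0) with hc | hc
  · simp [valueTerm, base, hc, branch]
    field_simp
  · simp [valueTerm, base, hc, branch]
    field_simp
    ring

lemma value_shift_succ (hQ : Q ∈ admissible) (c : ℕ → Fin 2) (n : ℕ) :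
    value Q (shift (n + 1) c) = branch Q (c n) (value Q (shift n c)) := by
  rw [← shift_shift, value_shift_one hQ]
  rfl

lemma value_shift_le_switchRight (hQ : Q ∈ admissible) {c : ℕ → Fin 2} {n : ℕ} (h : c n = 0) :
    value Q (shift n c) ≤ switchRight Q := by
  have h1 := value_shift_succ hQ c n
  rw [h, branch_zero] at h1
  have h2 := value_le_top hQ (shift (n + 1) c)
  have h3 := fst_mul_switchRight hQ
  exact le_of_mul_le_mul_left (by linarith) (by linarith [hQ.1] : 0 < Q.1)

lemma switchLeft_le_value_shift (hQ : Q ∈ admissible) {c : ℕ → Fin 2} {n : ℕ} (h : c n = 1) :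
    switchLeft Q ≤ value Q (shift n c) := by
  have h1 := value_shift_succ hQ c n
  rw [h, branch_one] at h1
  have h2 := value_nonneg hQ (shift (n + 1) c)
  have h3 := snd_mul_switchLeft hQ
  exact le_of_mul_le_mul_left (by linarith) (by linarith [hQ.2.1] : 0 < Q.2)

lemma eq_zero_of_value_eq_zero (hQ : Q ∈ admissible) {c : ℕ → Fin 2} (h : value Q c = 0) (n : ℕ) :
    c n = 0 := by
  have key : ∀ n, value Q (shift n c) = 0 → c n = 0 := fun n hn => by
    refine (fin_two (c n)).resolve_right fun h1 => ?_
    have := switchLeft_le_value_shift hQ h1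
    linarith [switchLeft_pos hQ]
  have : ∀ n, value Q (shift n c) = 0 := fun n => by
    induction n with
    | zero => rwa [shift_zero]
    | succ n ih => rw [value_shift_succ hQ, key n ih, branch_zero, ih, mul_zero]
  exact key n (this n)

lemma eq_one_of_value_eq_top (hQ : Q ∈ admissible) {c : ℕ → Fin 2} (h : value Q c = top Q)
    (n : ℕ) : c n = 1 := by
  have key : ∀ n, value Q (shift n c) = top Q → c n = 1 := fun n hn => by
    refine (fin_two (c n)).resolve_left fun h1 => ?_
    have := value_shift_le_switchRight hQ h1
    linarith [switchRight_lt_top hQ]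
  have : ∀ n, value Q (shift n c) = top Q := fun n => by
    induction n with
    | zero => rwa [shift_zero]
    | succ n ih =>
      rw [value_shift_succ hQ, key n ih, branch_one, ih, snd_mul_top hQ]
      ring
  exact key n (this n)

lemma value_zero_seq {c : ℕ → Fin 2} (h : ∀ n, c n = 0) : value Q c = 0 := by
  simp [value, h]

lemma value_one_seq (hQ : Q ∈ admissible) {c : ℕ → Fin 2} (h : ∀ n, c n = 1) :
    value Q c = top Q := by
  have h1 := value_shift_one hQ c
  have h2 : shift 1 c = c := by ext k; simp [shift, h]
  rw [h2, h, branch_one] at h1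
  have h3 := snd_mul_top hQ
  have h4 := hQ.2.1
  have : (Q.2 - 1) * (value Q c - top Q) = 0 := by linarith
  rcases mul_eq_zero.1 this with h5 | h5 <;> linarith

/-- The branches are expanding, so a common prefix pushes the tails of two expansions apart. -/
lemma sub_le_value_shift_sub (hQ : Q ∈ admissible) {c d : ℕ → Fin 2} (k : ℕ)
    (h : ∀ i < k, c i = d i) (hle : value Q c ≤ value Q d) :
    value Q d - value Q c ≤ value Q (shift k d) - value Q (shift k c) := by
  have hp := hQ.1
  have hq := hQ.2.1
  induction k with
  | zero => simp [shift_zero]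
  | succ k ih =>
    have h1 := ih fun i hi => h i (by omega)
    rw [value_shift_succ hQ, value_shift_succ hQ, h k (by omega)]
    rcases fin_two (d k) with hd | hd
    · rw [hd, branch_zero, branch_zero]
      nlinarith
    · rw [hd, branch_one, branch_one]
      nlinarith

/-! ### The lexicographic order -/

lemma lex_lt_iff {c d : ℕ → Fin 2} :
    toLex c < toLex d ↔ ∃ k, (∀ i < k, c i = d i) ∧ c k = 0 ∧ d k = 1 := by
  have key : ∀ a b : Fin 2, a < b ↔ a = 0 ∧ b = 1 := by decide
  constructor
  · rintro ⟨k, h, hk⟩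
    exact ⟨k, h, (key _ _).1 hk⟩
  · rintro ⟨k, h, hk⟩
    exact ⟨k, h, (key _ _).2 hk⟩

/-! ### Itineraries -/

/-- One step of the digit algorithm with the digit rule `δ`. -/
noncomputable def step (Q : ℝ × ℝ) (δ : ℝ → Fin 2) (x : ℝ) : ℝ := branch Q (δ x) x

/-- The digits produced from `x` by the digit rule `δ`. -/
noncomputable def itinerary (Q : ℝ × ℝ) (δ : ℝ → Fin 2) (x : ℝ) (n : ℕ) : Fin 2 :=
  δ ((step Q δ)^[n] x)

/-- The quasi-greedy digit rule. -/
noncomputable def greedyDigit (Q : ℝ × ℝ) (x : ℝ) : Fin 2 := if x ≤ switchLeft Q then 0 else 1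

/-- The quasi-lazy digit rule. -/
noncomputable def lazyDigit (Q : ℝ × ℝ) (x : ℝ) : Fin 2 := if x < switchRight Q then 0 else 1

lemma greedyDigit_eq_zero {x : ℝ} : greedyDigit Q x = 0 ↔ x ≤ switchLeft Q := by
  simp [greedyDigit]

lemma greedyDigit_eq_one {x : ℝ} : greedyDigit Q x = 1 ↔ switchLeft Q < x := by
  simp [greedyDigit]

lemma lazyDigit_eq_zero {x : ℝ} : lazyDigit Q x = 0 ↔ x < switchRight Q := by
  simp [lazyDigit]

lemma lazyDigit_eq_one {x : ℝ} : lazyDigit Q x = 1 ↔ switchRight Q ≤ x := by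
  simp [lazyDigit]

/-- A digit rule that keeps the orbits in `J_Q`. -/
def IsRule (Q : ℝ × ℝ) (δ : ℝ → Fin 2) : Prop :=
  ∀ x, (δ x = 0 → x ≤ switchRight Q) ∧ (δ x = 1 → switchLeft Q ≤ x)

lemma isRule_greedyDigit (hQ : Q ∈ admissible) : IsRule Q (greedyDigit Q) := fun _ =>
  ⟨fun h => (greedyDigit_eq_zero.1 h).trans (switchLeft_le_switchRight hQ),
    fun h => (greedyDigit_eq_one.1 h).le⟩

lemma isRule_lazyDigit (hQ : Q ∈ admissible) : IsRule Q (lazyDigit Q) := fun _ =>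
  ⟨fun h => (lazyDigit_eq_zero.1 h).le,
    fun h => (switchLeft_le_switchRight hQ).trans (lazyDigit_eq_one.1 h)⟩

/-- The map q₀x sends R to the top of J_Q, and q₁x - 1 sends L to 0 and fixes the top. -/
lemma branch_mem_Icc (hQ : Q ∈ admissible) {d : Fin 2} {x : ℝ} (hx : x ∈ Set.Icc 0 (top Q))
    (h0 : d = 0 → x ≤ switchRight Q) (h1 : d = 1 → switchLeft Q ≤ x) :
    branch Q d x ∈ Set.Icc 0 (top Q) := by
  have hp := hQ.1
  have hq := hQ.2.1
  have e1 := fst_mul_switchRight hQ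
  have e2 := snd_mul_switchLeft hQ
  have e3 := snd_mul_top hQ
  obtain ⟨hx0, hx1⟩ := hx
  rcases fin_two d with hd | hd
  · have := h0 hd
    rw [hd, branch_zero]
    constructor <;> nlinarith
  · have := h1 hd
    rw [hd, branch_one]
    constructor <;> nlinarith

lemma iterate_step_mem_Icc (hQ : Q ∈ admissible) {δ : ℝ → Fin 2} (hδ : IsRule Q δ) {x : ℝ}
    (hx : x ∈ Set.Icc 0 (top Q)) (n : ℕ) : (step Q δ)^[n] x ∈ Set.Icc 0 (top Q) := by
  induction n with
  | zero => exact hx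
  | succ n ih =>
    rw [Function.iterate_succ_apply']
    exact branch_mem_Icc hQ ih (hδ _).1 (hδ _).2

lemma shift_itinerary (δ : ℝ → Fin 2) (x : ℝ) (n : ℕ) :
    shift n (itinerary Q δ x) = itinerary Q δ ((step Q δ)^[n] x) := by
  ext k
  simp only [shift, itinerary, ← Function.iterate_add_apply, add_comm]

lemma abs_branch_sub_branch (hQ : Q ∈ admissible) (d : Fin 2) (x y : ℝ) :
    min Q.1 Q.2 * |x - y| ≤ |branch Q d x - branch Q d y| := by
  have hp := hQ.1
  have hq := hQ.2.1
  rcases fin_two d with hd | hd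
  · rw [hd, branch_zero, branch_zero, ← mul_sub, abs_mul, abs_of_pos (by linarith : 0 < Q.1)]
    exact mul_le_mul_of_nonneg_right (min_le_left _ _) (abs_nonneg _)
  · rw [hd, branch_one, branch_one, sub_sub_sub_cancel_right, ← mul_sub, abs_mul,
      abs_of_pos (by linarith : 0 < Q.2)]
    exact mul_le_mul_of_nonneg_right (min_le_right _ _) (abs_nonneg _)

lemma one_lt_min (hQ : Q ∈ admissible) : 1 < min Q.1 Q.2 := lt_min hQ.1 hQ.2.1

/-- A nonnegative quantity whose multiples by all powers of some `a > 1` are bounded vanishes. -/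
lemma eq_zero_of_pow_mul_le {a b x : ℝ} (ha : 1 < a) (hx : 0 ≤ x) (h : ∀ n : ℕ, a ^ n * x ≤ b) :
    x = 0 := by
  by_contra hne
  have hx' : 0 < x := lt_of_le_of_ne hx (Ne.symm hne)
  obtain ⟨n, hn⟩ := pow_unbounded_of_one_lt (b / x) ha
  rw [div_lt_iff₀ hx'] at hn
  linarith [h n]

/-- Removing the first digit applies the same branch to x and to the value of its itinerary, so
their distance grows by at least the factor min(q₀, q₁) per step. Both stay in J_Q, hence the
distance is zero. -/
lemma value_itinerary (hQ : Q ∈ admissible) {δ : ℝ → Fin 2} (hδ : IsRule Q δ) {x : ℝ}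
    (hx : x ∈ Set.Icc 0 (top Q)) : value Q (itinerary Q δ x) = x := by
  have key : ∀ n : ℕ, ∀ x ∈ Set.Icc 0 (top Q),
      min Q.1 Q.2 ^ n * |value Q (itinerary Q δ x) - x| ≤ top Q := by
    intro n
    induction n with
    | zero =>
      intro x hx
      have h1 := value_nonneg hQ (itinerary Q δ x)
      have h2 := value_le_top hQ (itinerary Q δ x)
      rw [pow_zero, one_mul, abs_le]
      constructor <;> linarith [hx.1, hx.2]
    | succ n ih =>
      intro x hx
      refine le_trans ?_ (ih (step Q δ x) (iterate_step_mem_Icc hQ hδ hx 1))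
      have h1 := value_shift_one hQ (itinerary Q δ x)
      rw [shift_itinerary, Function.iterate_one] at h1
      rw [h1, pow_succ, mul_assoc]
      have h2 := abs_branch_sub_branch hQ (δ x) (value Q (itinerary Q δ x)) x
      exact mul_le_mul_of_nonneg_left h2 (pow_nonneg (by linarith [one_lt_min hQ]) _)
  have := eq_zero_of_pow_mul_le (one_lt_min hQ) (abs_nonneg _) fun n => key n x hx
  linarith [abs_eq_zero.1 this]

lemma value_shift_eq_of_prefix (hQ : Q ∈ admissible) {c d : ℕ → Fin 2} {k : ℕ}
    (h : ∀ i < k, c i = d i) (hv : value Q c = value Q d) :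
    value Q (shift k c) = value Q (shift k d) := by
  have h1 := sub_le_value_shift_sub hQ k h hv.le
  have h2 := sub_le_value_shift_sub hQ k (fun i hi => (h i hi).symm) hv.ge
  linarith

lemma value_shift_itinerary (hQ : Q ∈ admissible) {δ : ℝ → Fin 2} (hδ : IsRule Q δ) {x : ℝ}
    (hx : x ∈ Set.Icc 0 (top Q)) (n : ℕ) :
    value Q (shift n (itinerary Q δ x)) = (step Q δ)^[n] x := by
  rw [shift_itinerary, value_itinerary hQ hδ (iterate_step_mem_Icc hQ hδ hx n)]

/-- The digit rule takes 1 whenever this leaves a positive remainder. A larger expansion would have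
to take 1 at a point not exceeding L, leaving remainder 0, and would end with 10^∞. -/
lemma isQuasiGreedy_itinerary (hQ : Q ∈ admissible) {x : ℝ} (hx : x ∈ Set.Icc 0 (top Q)) :
    IsQuasiGreedy Q x (itinerary Q (greedyDigit Q) x) := by
  have hr := isRule_greedyDigit hQ
  refine ⟨⟨?_, value_itinerary hQ hr hx⟩, fun d hd hv => ?_⟩
  · rintro ⟨n, h1, h0⟩
    have h2 := value_shift_succ hQ (itinerary Q (greedyDigit Q) x) n
    rw [h1, branch_one, value_zero_seq (c := shift (n + 1) (itinerary Q (greedyDigit Q) x))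
      (fun k => h0 (n + 1 + k) (by omega)), value_shift_itinerary hQ hr hx] at h2
    -- A tail 0^∞ after the digit 1 would put the orbit exactly at L, where the rule assigns the
    -- digit 0.
    have h3 := greedyDigit_eq_one.1 h1
    have h4 := snd_mul_switchLeft hQ
    nlinarith [hQ.2.1]
  · by_contra! hlt
    obtain ⟨k, hk, hc, hd1⟩ := lex_lt_iff.1 hlt
    have h1 := value_shift_eq_of_prefix hQ hk ((value_itinerary hQ hr hx).trans hv.symm)
    rw [value_shift_itinerary hQ hr hx] at h1
    have h2 := greedyDigit_eq_zero.1 hc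
    have h3 := value_shift_succ hQ d k
    rw [hd1, branch_one] at h3
    have h4 := snd_mul_switchLeft hQ
    have h5 : value Q (shift (k + 1) d) = 0 := by
      refine le_antisymm ?_ (value_nonneg hQ _)
      nlinarith [hQ.2.1]
    refine hd ⟨k, hd1, fun j hj => ?_⟩
    have := eq_zero_of_value_eq_zero hQ h5 (j - (k + 1))
    rwa [shift_apply, Nat.add_sub_cancel' hj] at this

lemma isQuasiLazy_itinerary (hQ : Q ∈ admissible) {x : ℝ} (hx : x ∈ Set.Icc 0 (top Q)) :
    IsQuasiLazy Q x (itinerary Q (lazyDigit Q) x) := by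
  have hr := isRule_lazyDigit hQ
  refine ⟨⟨?_, value_itinerary hQ hr hx⟩, fun d hd hv => ?_⟩
  · rintro ⟨n, h1, h0⟩
    have h2 := value_shift_succ hQ (itinerary Q (lazyDigit Q) x) n
    rw [h1, branch_zero, value_one_seq hQ (c := shift (n + 1) (itinerary Q (lazyDigit Q) x))
      (fun k => h0 (n + 1 + k) (by omega)), value_shift_itinerary hQ hr hx] at h2
    have h3 := lazyDigit_eq_zero.1 h1
    have h4 := fst_mul_switchRight hQ
    nlinarith [hQ.1]
  · by_contra! hlt
    obtain ⟨k, hk, hd0, hc⟩ := lex_lt_iff.1 hlt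
    have h1 := value_shift_eq_of_prefix hQ hk (hv.trans (value_itinerary hQ hr hx).symm)
    rw [value_shift_itinerary hQ hr hx] at h1
    have h2 := lazyDigit_eq_one.1 hc
    have h3 := value_shift_succ hQ d k
    rw [hd0, branch_zero] at h3
    have h4 := fst_mul_switchRight hQ
    have h5 : value Q (shift (k + 1) d) = top Q := by
      refine le_antisymm (value_le_top hQ _) ?_
      nlinarith [hQ.1]
    refine hd ⟨k, hd0, fun j hj => ?_⟩
    have := eq_one_of_value_eq_top hQ h5 (j - (k + 1))
    rwa [shift_apply, Nat.add_sub_cancel' hj] at this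

/-- The itinerary supplies the existence needed for the `epsilon` choice to satisfy its defining
property; maximality on both sides then forces equality. -/
lemma quasiGreedy_eq (hQ : Q ∈ admissible) {x : ℝ} (hx : x ∈ Set.Icc 0 (top Q)) :
    quasiGreedy Q x = itinerary Q (greedyDigit Q) x := by
  have h1 := isQuasiGreedy_itinerary hQ hx
  have h2 : IsQuasiGreedy Q x (quasiGreedy Q x) := Classical.epsilon_spec ⟨_, h1⟩
  exact toLex_inj.1 (le_antisymm (h1.2 _ h2.1.1 h2.1.2) (h2.2 _ h1.1.1 h1.1.2))

lemma quasiLazy_eq (hQ : Q ∈ admissible) {x : ℝ} (hx : x ∈ Set.Icc 0 (top Q)) :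
    quasiLazy Q x = itinerary Q (lazyDigit Q) x := by
  have h1 := isQuasiLazy_itinerary hQ hx
  have h2 : IsQuasiLazy Q x (quasiLazy Q x) := Classical.epsilon_spec ⟨_, h1⟩
  exact toLex_inj.1 (le_antisymm (h2.2 _ h1.1.1 h1.1.2) (h1.2 _ h2.1.1 h2.1.2))

/-- Up to the first differing digit both orbits use the same increasing branches, so their order is
preserved; there both points are compared with the same threshold. -/
lemma itinerary_greedyDigit_mono (hQ : Q ∈ admissible) {x y : ℝ} (hx : x ∈ Set.Icc 0 (top Q))
    (hy : y ∈ Set.Icc 0 (top Q)) (hxy : x ≤ y) :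
    toLex (itinerary Q (greedyDigit Q) x) ≤ toLex (itinerary Q (greedyDigit Q) y) := by
  have hr := isRule_greedyDigit hQ
  by_contra! hlt
  obtain ⟨k, hk, h0, h1⟩ := lex_lt_iff.1 hlt
  have h := sub_le_value_shift_sub hQ k (fun i hi => (hk i hi).symm)
    (by rwa [value_itinerary hQ hr hx, value_itinerary hQ hr hy])
  rw [value_shift_itinerary hQ hr hx, value_shift_itinerary hQ hr hy, value_itinerary hQ hr hx,
    value_itinerary hQ hr hy] at h
  have h2 := greedyDigit_eq_zero.1 h0
  have h3 := greedyDigit_eq_one.1 h1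
  linarith

lemma itinerary_lazyDigit_mono (hQ : Q ∈ admissible) {x y : ℝ} (hx : x ∈ Set.Icc 0 (top Q))
    (hy : y ∈ Set.Icc 0 (top Q)) (hxy : x ≤ y) :
    toLex (itinerary Q (lazyDigit Q) x) ≤ toLex (itinerary Q (lazyDigit Q) y) := by
  have hr := isRule_lazyDigit hQ
  by_contra! hlt
  obtain ⟨k, hk, h0, h1⟩ := lex_lt_iff.1 hlt
  have h := sub_le_value_shift_sub hQ k (fun i hi => (hk i hi).symm)
    (by rwa [value_itinerary hQ hr hx, value_itinerary hQ hr hy])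
  rw [value_shift_itinerary hQ hr hx, value_shift_itinerary hQ hr hy, value_itinerary hQ hr hx,
    value_itinerary hQ hr hy] at h
  have h2 := lazyDigit_eq_zero.1 h0
  have h3 := lazyDigit_eq_one.1 h1
  linarith

/-! ### The sequences `α` and `μ` -/

lemma switchLeft_mem_Icc (hQ : Q ∈ admissible) : switchLeft Q ∈ Set.Icc 0 (top Q) :=
  ⟨(switchLeft_pos hQ).le, (switchLeft_le_switchRight hQ).trans (switchRight_lt_top hQ).le⟩

lemma switchRight_mem_Icc (hQ : Q ∈ admissible) : switchRight Q ∈ Set.Icc 0 (top Q) :=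
  ⟨(switchLeft_pos hQ).le.trans (switchLeft_le_switchRight hQ), (switchRight_lt_top hQ).le⟩

lemma branch_zero_switchLeft_mem (hQ : Q ∈ admissible) :
    branch Q 0 (switchLeft Q) ∈ Set.Icc 0 (top Q) :=
  branch_mem_Icc hQ (switchLeft_mem_Icc hQ) (fun _ => switchLeft_le_switchRight hQ) (by simp)

lemma branch_one_switchRight_mem (hQ : Q ∈ admissible) :
    branch Q 1 (switchRight Q) ∈ Set.Icc 0 (top Q) :=
  branch_mem_Icc hQ (switchRight_mem_Icc hQ) (by simp) (fun _ => switchLeft_le_switchRight hQ)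

/-- The point q₀/q₁ is the image of L under the branch of digit 0, which is the greedy digit of L.
-/
lemma alpha_eq (hQ : Q ∈ admissible) :
    alpha Q = itinerary Q (greedyDigit Q) (branch Q 0 (switchLeft Q)) := by
  rw [← quasiGreedy_eq hQ (branch_zero_switchLeft_mem hQ), alpha, branch_zero, switchLeft,
    mul_one_div]

lemma mu_eq (hQ : Q ∈ admissible) :
    mu Q = itinerary Q (lazyDigit Q) (branch Q 1 (switchRight Q)) := by
  rw [← quasiLazy_eq hQ (branch_one_switchRight_mem hQ), mu, branch_one, switchRight,
    mul_one_div]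

lemma value_alpha (hQ : Q ∈ admissible) : value Q (alpha Q) = branch Q 0 (switchLeft Q) := by
  rw [alpha_eq hQ, value_itinerary hQ (isRule_greedyDigit hQ) (branch_zero_switchLeft_mem hQ)]

lemma value_mu (hQ : Q ∈ admissible) : value Q (mu Q) = branch Q 1 (switchRight Q) := by
  rw [mu_eq hQ, value_itinerary hQ (isRule_lazyDigit hQ) (branch_one_switchRight_mem hQ)]

lemma alpha_zero (hQ : Q ∈ admissible) : alpha Q 0 = 1 := by
  rw [alpha_eq hQ]
  refine greedyDigit_eq_one.2 ?_
  rw [Function.iterate_zero_apply, branch_zero]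
  nlinarith [switchLeft_pos hQ, hQ.1]

lemma mu_zero (hQ : Q ∈ admissible) : mu Q 0 = 0 := by
  rw [mu_eq hQ]
  refine lazyDigit_eq_zero.2 ?_
  rw [Function.iterate_zero_apply, branch_one]
  nlinarith [switchRight_lt_top hQ, hQ.2.1, snd_mul_top hQ]

lemma alpha_of_mem_curve (hQ : Q ∈ admissible) (hC : Q ∈ curve) (n : ℕ) : alpha Q n = 1 :=
  eq_one_of_value_eq_top hQ
    (by rw [value_alpha hQ, branch_zero, switchLeft_eq_switchRight hC, fst_mul_switchRight hQ]) n

lemma mu_of_mem_curve (hQ : Q ∈ admissible) (hC : Q ∈ curve) (n : ℕ) : mu Q n = 0 :=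
  eq_zero_of_value_eq_zero hQ
    (by rw [value_mu hQ, branch_one, ← switchLeft_eq_switchRight hC, snd_mul_switchLeft hQ,
      sub_self]) n

/-! ### From lexicographic conditions to inequalities between values. -/

/-- The growth step: a tail starting with 1 and lying below R by some defect leads to a later such
tail with defect more than q₁ times as large. At the first place where μ and the remaining tail
differ, μ has digit 0, so its lazy orbit is strictly left of R; the common prefix has only enlarged
the difference of the values. -/
lemma exists_of_mu_lt (hQ : Q ∈ admissible) {c : ℕ → Fin 2} {n : ℕ} (hc : c n = 1)
    (hlt : toLex (mu Q) < toLex (shift (n + 1) c)) (hy : value Q (shift n c) ≤ switchRight Q) :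
    ∃ m, c m = 1 ∧
      Q.2 * (switchRight Q - value Q (shift n c)) < switchRight Q - value Q (shift m c) := by
  obtain ⟨k, hk, h0, h1⟩ := lex_lt_iff.1 hlt
  have hv := value_shift_succ hQ c n
  rw [hc, branch_one] at hv
  have hm := value_mu hQ
  rw [branch_one] at hm
  have h := sub_le_value_shift_sub hQ k (fun i hi => (hk i hi).symm)
    (by rw [hv, hm]; nlinarith [hQ.2.1])
  have h2 : value Q (shift k (mu Q)) < switchRight Q := by
    rw [mu_eq hQ] at h0 ⊢
    rw [value_shift_itinerary hQ (isRule_lazyDigit hQ) (branch_one_switchRight_mem hQ)]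
    exact lazyDigit_eq_zero.1 h0
  rw [shift_shift, hv, hm] at h
  refine ⟨n + 1 + k, h1, ?_⟩
  linarith

lemma exists_of_lt_alpha (hQ : Q ∈ admissible) {c : ℕ → Fin 2} {n : ℕ} (hc : c n = 0)
    (hlt : toLex (shift (n + 1) c) < toLex (alpha Q)) (hy : switchLeft Q ≤ value Q (shift n c)) :
    ∃ m, c m = 0 ∧
      Q.1 * (value Q (shift n c) - switchLeft Q) < value Q (shift m c) - switchLeft Q := by
  obtain ⟨k, hk, h0, h1⟩ := lex_lt_iff.1 hlt
  have hv := value_shift_succ hQ c n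
  rw [hc, branch_zero] at hv
  have hm := value_alpha hQ
  rw [branch_zero] at hm
  have h := sub_le_value_shift_sub hQ k (fun i hi => (hk i hi).symm)
    (by rw [hv, hm]; nlinarith [hQ.1])
  have h2 : switchLeft Q < value Q (shift k (alpha Q)) := by
    rw [alpha_eq hQ] at h1 ⊢
    rw [value_shift_itinerary hQ (isRule_greedyDigit hQ) (branch_zero_switchLeft_mem hQ)]
    exact greedyDigit_eq_one.1 h1
  rw [shift_shift, hv, hm] at h
  refine ⟨n + 1 + k, h0, ?_⟩
  linarith

/-- A positive defect below R could be multiplied by q₁ again and again, although it never exceeds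
R. -/
lemma switchRight_le_value_shift (hQ : Q ∈ admissible) {c : ℕ → Fin 2}
    (h : ∀ j, c j = 1 → toLex (mu Q) ≤ toLex (shift (j + 1) c)) {n : ℕ} (hn : c n = 1) :
    switchRight Q ≤ value Q (shift n c) := by
  by_contra! hlt
  have hq := hQ.2.1
  have key : ∀ N : ℕ, ∃ m, c m = 1 ∧ Q.2 ^ N * (switchRight Q - value Q (shift n c)) ≤
      switchRight Q - value Q (shift m c) := by
    intro N
    induction N with
    | zero => exact ⟨n, hn, by simp⟩
    | succ N ih =>
      obtain ⟨m, hm, hle⟩ := ih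
      have hpos : 0 < switchRight Q - value Q (shift m c) :=
        lt_of_lt_of_le (mul_pos (pow_pos (by linarith) N) (by linarith)) hle
      -- Equality would make the tail at `m` have value exactly R, that is, defect zero. So the weak
      -- hypothesis is strict here and the growth step applies.
      have hne : mu Q ≠ shift (m + 1) c := fun he => by
        have h1 := value_shift_succ hQ c m
        rw [← he, value_mu hQ, hm, branch_one, branch_one] at h1
        nlinarith
      obtain ⟨m', hm', hlt'⟩ := exists_of_mu_lt hQ hm
        (lt_of_le_of_ne (h m hm) fun he => hne (toLex_inj.1 he)) (by linarith)
      refine ⟨m', hm', ?_⟩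
      rw [pow_succ', mul_assoc]
      nlinarith
  have := eq_zero_of_pow_mul_le hq (by linarith : 0 ≤ switchRight Q - value Q (shift n c))
    (b := switchRight Q) fun N => by
      obtain ⟨m, -, hle⟩ := key N
      linarith [value_nonneg hQ (shift m c)]
  linarith

lemma value_shift_le_switchLeft (hQ : Q ∈ admissible) {c : ℕ → Fin 2}
    (h : ∀ j, c j = 0 → toLex (shift (j + 1) c) ≤ toLex (alpha Q)) {n : ℕ} (hn : c n = 0) :
    value Q (shift n c) ≤ switchLeft Q := by
  by_contra! hlt
  have hp := hQ.1
  have key : ∀ N : ℕ, ∃ m, c m = 0 ∧ Q.1 ^ N * (value Q (shift n c) - switchLeft Q) ≤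
      value Q (shift m c) - switchLeft Q := by
    intro N
    induction N with
    | zero => exact ⟨n, hn, by simp⟩
    | succ N ih =>
      obtain ⟨m, hm, hle⟩ := ih
      have hpos : 0 < value Q (shift m c) - switchLeft Q :=
        lt_of_lt_of_le (mul_pos (pow_pos (by linarith) N) (by linarith)) hle
      have hne : shift (m + 1) c ≠ alpha Q := fun he => by
        have h1 := value_shift_succ hQ c m
        rw [he, value_alpha hQ, hm, branch_zero, branch_zero] at h1
        nlinarith
      obtain ⟨m', hm', hlt'⟩ := exists_of_lt_alpha hQ hm
        (lt_of_le_of_ne (h m hm) fun he => hne (toLex_inj.1 he)) (by linarith)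
      refine ⟨m', hm', ?_⟩
      rw [pow_succ', mul_assoc]
      nlinarith
  have := eq_zero_of_pow_mul_le hp (by linarith : 0 ≤ value Q (shift n c) - switchLeft Q)
    (b := top Q) fun N => by
      obtain ⟨m, -, hle⟩ := key N
      linarith [value_le_top hQ (shift m c), switchLeft_pos hQ]
  linarith

/-- Under strict conditions the growth step applies at value R as well, and it produces a tail
strictly below R, which the weak version excludes. -/
lemma switchRight_lt_value_shift (hQ : Q ∈ admissible) {c : ℕ → Fin 2}
    (h : ∀ j, c j = 1 → toLex (mu Q) < toLex (shift (j + 1) c)) {n : ℕ} (hn : c n = 1) :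
    switchRight Q < value Q (shift n c) := by
  by_contra! hle
  obtain ⟨m, hm, hlt⟩ := exists_of_mu_lt hQ hn (h n hn) hle
  have := switchRight_le_value_shift hQ (fun j hj => (h j hj).le) hm
  nlinarith [hQ.2.1]

lemma value_shift_lt_switchLeft (hQ : Q ∈ admissible) {c : ℕ → Fin 2}
    (h : ∀ j, c j = 0 → toLex (shift (j + 1) c) < toLex (alpha Q)) {n : ℕ} (hn : c n = 0) :
    value Q (shift n c) < switchLeft Q := by
  by_contra! hle
  obtain ⟨m, hm, hlt⟩ := exists_of_lt_alpha hQ hn (h n hn) hle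
  have := value_shift_le_switchLeft hQ (fun j hj => (h j hj).le) hm
  nlinarith [hQ.1]

/-! ### Dynamical description of `𝒱` and `𝒰` -/

/-- The quasi-greedy map. -/
noncomputable def greedyMap (Q : ℝ × ℝ) : ℝ → ℝ := step Q (greedyDigit Q)

/-- The points whose orbit never enters the interior of the switch region. -/
def survivor (Q : ℝ × ℝ) : Set ℝ :=
  {x | ∀ n, (greedyMap Q)^[n] x ∈ Set.Icc 0 (switchLeft Q) ∪ Set.Icc (switchRight Q) (top Q)}

/-- The points whose orbit never enters the switch region. -/
def strictSurvivor (Q : ℝ × ℝ) : Set ℝ :=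
  {x | ∀ n, (greedyMap Q)^[n] x ∈ Set.Ico 0 (switchLeft Q) ∪ Set.Ioc (switchRight Q) (top Q)}

/-- The points whose orbit contains `a`. -/
def hits (Q : ℝ × ℝ) (a : ℝ) : Set ℝ := {x | ∃ n, (greedyMap Q)^[n] x = a}

lemma greedyMap_of_le {x : ℝ} (h : x ≤ switchLeft Q) : greedyMap Q x = Q.1 * x := by
  rw [greedyMap, step, greedyDigit_eq_zero.2 h, branch_zero]

lemma greedyMap_of_lt {x : ℝ} (h : switchLeft Q < x) : greedyMap Q x = Q.2 * x - 1 := by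
  rw [greedyMap, step, greedyDigit_eq_one.2 h, branch_one]

lemma survivor_subset (hQ : Q ∈ admissible) : survivor Q ⊆ Set.Icc 0 (top Q) := fun x hx => by
  have h1 := switchLeft_mem_Icc hQ
  have h2 := switchRight_mem_Icc hQ
  rcases hx 0 with h | h
  · exact ⟨h.1, h.2.trans h1.2⟩
  · exact ⟨h2.1.trans h.1, h.2⟩

lemma strictSurvivor_subset : strictSurvivor Q ⊆ survivor Q := fun _ hx n =>
  (hx n).imp (fun h => ⟨h.1, h.2.le⟩) fun h => ⟨h.1.le, h.2⟩

lemma lazyDigit_eq_greedyDigit {x : ℝ} (hlt : switchLeft Q < switchRight Q)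
    (hx : x ∈ Set.Icc 0 (switchLeft Q) ∪ Set.Icc (switchRight Q) (top Q)) :
    lazyDigit Q x = greedyDigit Q x := by
  rcases hx with h | h
  · rw [greedyDigit_eq_zero.2 h.2, lazyDigit_eq_zero.2 (h.2.trans_lt hlt)]
  · rw [greedyDigit_eq_one.2 (hlt.trans_le h.1), lazyDigit_eq_one.2 h.1]

lemma lazyDigit_eq_greedyDigit' {x : ℝ} (hlt : switchLeft Q ≤ switchRight Q)
    (hx : x ∈ Set.Ico 0 (switchLeft Q) ∪ Set.Ioc (switchRight Q) (top Q)) :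
    lazyDigit Q x = greedyDigit Q x := by
  rcases hx with h | h
  · rw [greedyDigit_eq_zero.2 h.2.le, lazyDigit_eq_zero.2 (h.2.trans_le hlt)]
  · rw [greedyDigit_eq_one.2 (hlt.trans_lt h.1), lazyDigit_eq_one.2 h.1.le]

lemma iterate_step_congr {δ δ' : ℝ → Fin 2} {x : ℝ}
    (h : ∀ n, δ' ((step Q δ)^[n] x) = δ ((step Q δ)^[n] x)) (n : ℕ) :
    (step Q δ')^[n] x = (step Q δ)^[n] x := by
  induction n with
  | zero => rfl
  | succ n ih =>
    rw [Function.iterate_succ_apply', Function.iterate_succ_apply', ih, step, h n, ← step]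

lemma itinerary_congr {δ δ' : ℝ → Fin 2} {x : ℝ}
    (h : ∀ n, δ' ((step Q δ)^[n] x) = δ ((step Q δ)^[n] x)) :
    itinerary Q δ' x = itinerary Q δ x := by
  ext n
  rw [itinerary, itinerary, iterate_step_congr h, h]

lemma itinerary_lazy_of_mem_survivor (hlt : switchLeft Q < switchRight Q) {x : ℝ}
    (hx : x ∈ survivor Q) : itinerary Q (lazyDigit Q) x = itinerary Q (greedyDigit Q) x :=
  itinerary_congr fun n => lazyDigit_eq_greedyDigit hlt (hx n)

lemma itinerary_lazy_of_mem_strictSurvivor (hQ : Q ∈ admissible) {x : ℝ}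
    (hx : x ∈ strictSurvivor Q) : itinerary Q (lazyDigit Q) x = itinerary Q (greedyDigit Q) x :=
  itinerary_congr fun n => lazyDigit_eq_greedyDigit' (switchLeft_le_switchRight hQ) (hx n)

lemma greedyMap_iterate_mem_survivor {x : ℝ} (hx : x ∈ survivor Q) (n : ℕ) :
    (greedyMap Q)^[n] x ∈ survivor Q := fun m => by
  rw [← Function.iterate_add_apply]
  exact hx (m + n)

lemma greedyMap_iterate_mem_strictSurvivor {x : ℝ} (hx : x ∈ strictSurvivor Q) (n : ℕ) :
    (greedyMap Q)^[n] x ∈ strictSurvivor Q := fun m => by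
  rw [← Function.iterate_add_apply]
  exact hx (m + n)

lemma lex_le_of_zero {c d : ℕ → Fin 2} (h : ∀ n, c n = 0) : toLex c ≤ toLex d := by
  by_contra! hlt
  obtain ⟨k, -, -, h1⟩ := lex_lt_iff.1 hlt
  simp [h] at h1

lemma lex_le_of_one {c d : ℕ → Fin 2} (h : ∀ n, d n = 1) : toLex c ≤ toLex d := by
  by_contra! hlt
  obtain ⟨k, -, h1, -⟩ := lex_lt_iff.1 hlt
  simp [h] at h1

lemma survivor_of_mem_curve (hQ : Q ∈ admissible) (hC : Q ∈ curve) :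
    survivor Q = Set.Icc 0 (top Q) := by
  refine (survivor_subset hQ).antisymm fun x hx n => ?_
  have h := iterate_step_mem_Icc hQ (isRule_greedyDigit hQ) hx n
  rw [← switchLeft_eq_switchRight hC, Set.Icc_union_Icc_eq_Icc (switchLeft_mem_Icc hQ).1
    (switchLeft_mem_Icc hQ).2]
  exact h

/-- A greedy digit 0 means by definition that the orbit is in [0, L]; only the digits 1 need the
lexicographic condition. -/
lemma mem_survivor_of_mu_le (hQ : Q ∈ admissible) {x : ℝ} (hx : x ∈ Set.Icc 0 (top Q))
    (h : ∀ j, itinerary Q (greedyDigit Q) x j = 1 →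
      toLex (mu Q) ≤ toLex (shift (j + 1) (itinerary Q (greedyDigit Q) x))) :
    x ∈ survivor Q := fun n => by
  have hr := isRule_greedyDigit hQ
  have hI := iterate_step_mem_Icc hQ hr hx n
  rcases fin_two (itinerary Q (greedyDigit Q) x n) with h0 | h1
  · exact .inl ⟨hI.1, greedyDigit_eq_zero.1 h0⟩
  · have := switchRight_le_value_shift hQ h h1
    rw [value_shift_itinerary hQ hr hx] at this
    exact .inr ⟨this, hI.2⟩

lemma mem_survivor_of_le_alpha (hQ : Q ∈ admissible) {x : ℝ} (hx : x ∈ Set.Icc 0 (top Q))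
    (h : ∀ j, itinerary Q (lazyDigit Q) x j = 0 →
      toLex (shift (j + 1) (itinerary Q (lazyDigit Q) x)) ≤ toLex (alpha Q)) :
    x ∈ survivor Q := by
  by_cases hC : Q ∈ curve
  · rwa [survivor_of_mem_curve hQ hC]
  have hr := isRule_lazyDigit hQ
  have key : ∀ n, (step Q (lazyDigit Q))^[n] x ∈
      Set.Icc 0 (switchLeft Q) ∪ Set.Icc (switchRight Q) (top Q) := fun n => by
    have hI := iterate_step_mem_Icc hQ hr hx n
    rcases fin_two (itinerary Q (lazyDigit Q) x n) with h0 | h1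
    · have := value_shift_le_switchLeft hQ h h0
      rw [value_shift_itinerary hQ hr hx] at this
      exact .inl ⟨hI.1, this⟩
    · exact .inr ⟨lazyDigit_eq_one.1 h1, hI.2⟩
  intro n
  -- The two digit rules agree outside the open hole when L < R, so the lazy orbit just controlled
  -- is also the greedy orbit.
  have := iterate_step_congr fun n =>
    (lazyDigit_eq_greedyDigit (switchLeft_lt_switchRight hQ hC) (key n)).symm
  rw [greedyMap, this n]
  exact key n

/-- A surviving orbit point with digit 1 is at least R, so its image is at least that of R. Off the
curve greedy and lazy itineraries of survivors coincide, and monotonicity of the lazy ones gives the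
comparison with μ. -/
lemma mu_le_of_mem_survivor (hQ : Q ∈ admissible) {x : ℝ} (hx : x ∈ survivor Q) (j : ℕ)
    (hj : itinerary Q (greedyDigit Q) x j = 1) :
    toLex (mu Q) ≤ toLex (shift (j + 1) (itinerary Q (greedyDigit Q) x)) := by
  by_cases hC : Q ∈ curve
  · exact lex_le_of_zero (mu_of_mem_curve hQ hC)
  have hlt := switchLeft_lt_switchRight hQ hC
  have hy := greedyMap_iterate_mem_survivor hx (j + 1)
  have h1 : switchLeft Q < (greedyMap Q)^[j] x := greedyDigit_eq_one.1 hj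
  have h2 : switchRight Q ≤ (greedyMap Q)^[j] x := by
    rcases hx j with h | h
    · linarith [h.2]
    · exact h.1
  rw [shift_itinerary, ← greedyMap, ← itinerary_lazy_of_mem_survivor hlt hy, mu_eq hQ]
  refine itinerary_lazyDigit_mono hQ (branch_one_switchRight_mem hQ) (survivor_subset hQ hy) ?_
  rw [Function.iterate_succ_apply', greedyMap_of_lt h1, branch_one]
  nlinarith [hQ.2.1]

lemma le_alpha_of_mem_survivor (hQ : Q ∈ admissible) {x : ℝ} (hx : x ∈ survivor Q) (j : ℕ)
    (hj : itinerary Q (lazyDigit Q) x j = 0) :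
    toLex (shift (j + 1) (itinerary Q (lazyDigit Q) x)) ≤ toLex (alpha Q) := by
  by_cases hC : Q ∈ curve
  · exact lex_le_of_one (alpha_of_mem_curve hQ hC)
  have hlt := switchLeft_lt_switchRight hQ hC
  have hy := greedyMap_iterate_mem_survivor hx (j + 1)
  rw [itinerary_lazy_of_mem_survivor hlt hx] at hj ⊢
  have h1 : (greedyMap Q)^[j] x ≤ switchLeft Q := greedyDigit_eq_zero.1 hj
  rw [shift_itinerary, ← greedyMap, alpha_eq hQ]
  refine itinerary_greedyDigit_mono hQ (survivor_subset hQ hy) (branch_zero_switchLeft_mem hQ) ?_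
  rw [Function.iterate_succ_apply', greedyMap_of_le h1, branch_zero]
  nlinarith [hQ.1]

lemma weakUnivoque_eq (hQ : Q ∈ admissible) : weakUnivoque Q = survivor Q := by
  ext x
  constructor
  -- Either half of the definition already forces survival; the greedy half is the direct one.
  · rintro ⟨hx, -, h⟩
    rw [quasiGreedy_eq hQ hx] at h
    exact mem_survivor_of_mu_le hQ hx h
  · intro h
    have hx := survivor_subset hQ h
    refine ⟨hx, ?_, ?_⟩
    · rw [quasiLazy_eq hQ hx]
      exact le_alpha_of_mem_survivor hQ h
    · rw [quasiGreedy_eq hQ hx]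
      exact mu_le_of_mem_survivor hQ h

lemma univoque_eq (hQ : Q ∈ admissible) : univoque Q = strictSurvivor Q := by
  have hr := isRule_greedyDigit hQ
  ext x
  constructor
  · rintro ⟨hx, c, rfl, h0, h1⟩
    have key : ∀ n, value Q (shift n c) ∈
        Set.Ico 0 (switchLeft Q) ∪ Set.Ioc (switchRight Q) (top Q) := fun n => by
      rcases fin_two (c n) with hc | hc
      · exact .inl ⟨value_nonneg hQ _, value_shift_lt_switchLeft hQ h0 hc⟩
      · exact .inr ⟨switchRight_lt_value_shift hQ h1 hc, value_le_top hQ _⟩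
    -- The expansion `c` is not assumed greedy. Its tails lie on the correct side of [L, R], which
    -- makes each digit the greedy one.
    have horb : ∀ n, (greedyMap Q)^[n] (value Q c) = value Q (shift n c) := fun n => by
      induction n with
      | zero => rw [Function.iterate_zero_apply, shift_zero]
      | succ n ih =>
        rw [Function.iterate_succ_apply', ih, value_shift_succ hQ]
        rcases fin_two (c n) with hc | hc
        · rw [greedyMap_of_le (value_shift_lt_switchLeft hQ h0 hc).le, hc, branch_zero]
        · rw [greedyMap_of_lt ((switchLeft_le_switchRight hQ).trans_lt
            (switchRight_lt_value_shift hQ h1 hc)), hc, branch_one]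
    intro n
    rw [horb]
    exact key n
  · intro h
    have hx := survivor_subset hQ (strictSurvivor_subset h)
    have hit : ∀ n, (greedyMap Q)^[n] x ∈ Set.Icc 0 (top Q) := fun n =>
      survivor_subset hQ (greedyMap_iterate_mem_survivor (strictSurvivor_subset h) n)
    refine ⟨hx, _, value_itinerary hQ hr hx, fun j hj => ?_, fun j hj => ?_⟩
    · have h1 : (greedyMap Q)^[j] x ≤ switchLeft Q := greedyDigit_eq_zero.1 hj
      have h2 : (greedyMap Q)^[j] x < switchLeft Q := by
        rcases h j with h | h
        · exact h.2
        · linarith [h.1, switchLeft_le_switchRight hQ]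
      have h3 : (greedyMap Q)^[j + 1] x < branch Q 0 (switchLeft Q) := by
        rw [Function.iterate_succ_apply', greedyMap_of_le h1, branch_zero]
        nlinarith [hQ.1]
      rw [shift_itinerary, ← greedyMap]
      -- Monotonicity gives the weak inequality; equal sequences would have equal values, against
      -- the strict inequality between the points.
      refine lt_of_le_of_ne ?_ fun he => ?_
      · rw [alpha_eq hQ]
        exact itinerary_greedyDigit_mono hQ (hit _) (branch_zero_switchLeft_mem hQ) h3.le
      · have h4 := value_alpha hQ
        rw [← toLex_inj.1 he, value_itinerary hQ hr (hit _)] at h4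
        exact h3.ne h4
    · have h1 : switchLeft Q < (greedyMap Q)^[j] x := greedyDigit_eq_one.1 hj
      have h2 : switchRight Q < (greedyMap Q)^[j] x := by
        rcases h j with h | h
        · linarith [h.2]
        · exact h.1
      have h3 : branch Q 1 (switchRight Q) < (greedyMap Q)^[j + 1] x := by
        rw [Function.iterate_succ_apply', greedyMap_of_lt h1, branch_one]
        nlinarith [hQ.2.1]
      rw [shift_itinerary, ← greedyMap,
        ← itinerary_lazy_of_mem_strictSurvivor hQ (greedyMap_iterate_mem_strictSurvivor h _)]
      refine lt_of_le_of_ne ?_ fun he => ?_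
      · rw [mu_eq hQ]
        exact itinerary_lazyDigit_mono hQ (branch_one_switchRight_mem hQ) (hit _) h3.le
      · have h4 := value_mu hQ
        rw [toLex_inj.1 he, value_itinerary hQ (isRule_lazyDigit hQ) (hit _)] at h4
        exact h3.ne' h4

/-! ### The orbits of the endpoints of the switch region -/

lemma mem_survivor_of_greedyMap_mem {x : ℝ}
    (hx : x ∈ Set.Icc 0 (switchLeft Q) ∪ Set.Icc (switchRight Q) (top Q))
    (h : greedyMap Q x ∈ survivor Q) : x ∈ survivor Q := fun n => by
  cases n with
  | zero => exact hx
  | succ n => exact h n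

lemma greedyMap_switchLeft : greedyMap Q (switchLeft Q) = branch Q 0 (switchLeft Q) := by
  rw [greedyMap_of_le le_rfl, branch_zero]

lemma greedyMap_switchRight (hlt : switchLeft Q < switchRight Q) :
    greedyMap Q (switchRight Q) = branch Q 1 (switchRight Q) := by
  rw [greedyMap_of_lt hlt, branch_one]

/-- L survives exactly when its image does, and α is the greedy itinerary of that image; the
condition on the digits 1 of α is the criterion for survival. -/
lemma switchLeft_mem_survivor_iff (hQ : Q ∈ admissible) :
    switchLeft Q ∈ survivor Q ↔ ¬ FallsBelowMu (mu Q) (alpha Q) := by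
  have hb := branch_zero_switchLeft_mem hQ
  have h1 : switchLeft Q ∈ survivor Q ↔ branch Q 0 (switchLeft Q) ∈ survivor Q := by
    rw [← greedyMap_switchLeft]
    exact ⟨fun h => greedyMap_iterate_mem_survivor h 1,
      mem_survivor_of_greedyMap_mem (.inl ⟨(switchLeft_pos hQ).le, le_rfl⟩)⟩
  rw [h1, FallsBelowMu, alpha_eq hQ]
  simp only [not_exists, not_and]
  exact ⟨fun h j hj => (mu_le_of_mem_survivor hQ h j hj).not_gt,
    fun h => mem_survivor_of_mu_le hQ hb fun j hj => not_lt.1 (h j hj)⟩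

lemma switchRight_mem_survivor_iff (hQ : Q ∈ admissible) (hlt : switchLeft Q < switchRight Q) :
    switchRight Q ∈ survivor Q ↔ ¬ ExceedsAlpha (mu Q) (alpha Q) := by
  have hb := branch_one_switchRight_mem hQ
  have h1 : switchRight Q ∈ survivor Q ↔ branch Q 1 (switchRight Q) ∈ survivor Q := by
    rw [← greedyMap_switchRight hlt]
    exact ⟨fun h => greedyMap_iterate_mem_survivor h 1,
      mem_survivor_of_greedyMap_mem (.inr ⟨le_rfl, (switchRight_lt_top hQ).le⟩)⟩
  rw [h1, ExceedsAlpha, mu_eq hQ]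
  simp only [not_exists, not_and]
  exact ⟨fun h j hj => (le_alpha_of_mem_survivor hQ h j hj).not_gt,
    fun h => mem_survivor_of_le_alpha hQ hb fun j hj => not_lt.1 (h j hj)⟩

lemma not_fallsBelowMu_of_le {μ α : ℕ → Fin 2}
    (h : ∀ i, 1 ≤ i → toLex μ ≤ toLex (shift i α)) : ¬ FallsBelowMu μ α :=
  fun ⟨j, _, hj⟩ => (h (j + 1) (by omega)).not_gt hj

lemma not_exceedsAlpha_of_le {μ α : ℕ → Fin 2}
    (h : ∀ i, 1 ≤ i → toLex (shift i μ) ≤ toLex α) : ¬ ExceedsAlpha μ α :=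
  fun ⟨j, _, hj⟩ => (h (j + 1) (by omega)).not_gt hj

/-- If the orbit of L reached R, the next tail of α would be the itinerary of the image of R, namely
μ. -/
lemma switchLeft_notMem_hits (hQ : Q ∈ admissible) (hlt : switchLeft Q < switchRight Q)
    (h : LtShifts (mu Q) (alpha Q)) : switchLeft Q ∉ hits Q (switchRight Q) := by
  rintro ⟨n, hn⟩
  cases n with
  | zero => exact hlt.ne hn
  | succ n =>
    have hV := (switchLeft_mem_survivor_iff hQ).2 (not_fallsBelowMu_of_le fun i hi => (h i hi).le)
    have hV' := greedyMap_iterate_mem_survivor hV (n + 2)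
    have h1 := h (n + 1) (by omega)
    rw [Function.iterate_succ_apply', hn, greedyMap_switchRight hlt] at hV'
    rw [alpha_eq hQ, shift_itinerary, ← greedyMap, ← greedyMap_switchLeft,
      ← Function.iterate_succ_apply, Function.iterate_succ_apply', hn, greedyMap_switchRight hlt,
      ← itinerary_lazy_of_mem_survivor hlt hV', ← mu_eq hQ] at h1
    exact lt_irrefl _ h1

lemma switchRight_notMem_hits (hQ : Q ∈ admissible) (hlt : switchLeft Q < switchRight Q)
    (h : ShiftsLt (mu Q) (alpha Q)) : switchRight Q ∉ hits Q (switchLeft Q) := by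
  rintro ⟨n, hn⟩
  cases n with
  | zero => exact hlt.ne' hn
  | succ n =>
    have hV := (switchRight_mem_survivor_iff hQ hlt).2
      (not_exceedsAlpha_of_le fun i hi => (h i hi).le)
    have hV' := greedyMap_iterate_mem_survivor hV 1
    have h1 := h (n + 1) (by omega)
    rw [Function.iterate_one, greedyMap_switchRight hlt] at hV'
    rw [mu_eq hQ, itinerary_lazy_of_mem_survivor hlt hV', shift_itinerary, ← greedyMap,
      ← greedyMap_switchRight hlt, ← Function.iterate_succ_apply, Function.iterate_succ_apply', hn,
      greedyMap_switchLeft, ← alpha_eq hQ] at h1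
    exact lt_irrefl _ h1

/-- A shift of α equal to μ says that the orbit of L reaches the image of R. To conclude that it was
at R one step earlier, the digit preceding μ must be 1. -/
lemma switchLeft_mem_hits (hQ : Q ∈ admissible) (hlt : switchLeft Q < switchRight Q)
    (h : LeShifts (mu Q) (alpha Q)) : switchLeft Q ∈ hits Q (switchRight Q) := by
  obtain ⟨hle, i, hi, he⟩ := h
  obtain ⟨n, rfl⟩ : ∃ n, i = n + 1 := ⟨i - 1, by omega⟩
  have hr := isRule_greedyDigit hQ
  have hb := branch_zero_switchLeft_mem hQ
  have hv := value_shift_succ hQ (alpha Q) n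
  rw [← he, value_mu hQ] at hv
  have hd : alpha Q n = 1 := by
    refine (fin_two _).resolve_left fun h0 => ?_
    obtain ⟨m, rfl⟩ : ∃ m, n = m + 1 := by
      refine ⟨n - 1, ?_⟩
      rcases n.eq_zero_or_pos with rfl | hn
      · rw [alpha_zero hQ] at h0
        exact absurd h0 (by decide)
      · omega
    have h1 := hle (m + 1) (by omega)
    have h2 : ∀ k, shift (m + 1) (alpha Q) (k + 1) = mu Q k := fun k => by
      rw [he, shift_apply, shift_apply]
      congr 1
      omega
    -- The tail is 0μ. Since μ is not 0^∞ when L < R, the first 1 of μ occurs one place later in 0μ,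
    -- so 0μ ≺ μ, against the weak inequality for that shift.
    have h3 : toLex (shift (m + 1) (alpha Q)) < toLex (mu Q) := by
      have : ∃ k, mu Q k = 1 := by
        by_contra! hno
        have h4 := value_zero_seq (Q := Q) fun k => (fin_two (mu Q k)).resolve_right (hno k)
        rw [value_mu hQ, branch_one] at h4
        nlinarith [snd_mul_switchLeft hQ, hQ.2.1]
      classical
      have hk := Nat.find_spec this
      have hmin := fun j hj => (fin_two (mu Q j)).resolve_right (Nat.find_min this (m := j) hj)
      refine lex_lt_iff.2 ⟨Nat.find this, fun j hj => ?_, ?_, hk⟩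
      · rw [hmin j hj]
        cases j with
        | zero => exact h0
        | succ j =>
          rw [h2]
          exact hmin j (by omega)
      · obtain ⟨k, hk'⟩ : ∃ k, Nat.find this = k + 1 := by
          refine ⟨Nat.find this - 1, ?_⟩
          have : Nat.find this ≠ 0 := fun h0 => by
            rw [h0, mu_zero hQ] at hk
            exact absurd hk (by decide)
          omega
        rw [hk', h2]
        exact hmin k (by omega)
    exact h1.not_gt h3
  rw [hd, branch_one, branch_one] at hv
  refine ⟨n + 1, ?_⟩
  rw [Function.iterate_succ_apply, greedyMap_switchLeft]
  rw [alpha_eq hQ, value_shift_itinerary hQ hr hb] at hv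
  have : Q.2 * (switchRight Q - (greedyMap Q)^[n] (branch Q 0 (switchLeft Q))) = 0 := by
    rw [greedyMap]
    linarith
  rcases mul_eq_zero.1 this with h5 | h5 <;> linarith [hQ.2.1]

lemma switchRight_mem_hits (hQ : Q ∈ admissible) (hlt : switchLeft Q < switchRight Q)
    (h : ShiftsLe (mu Q) (alpha Q)) : switchRight Q ∈ hits Q (switchLeft Q) := by
  obtain ⟨hle, i, hi, he⟩ := h
  obtain ⟨n, rfl⟩ : ∃ n, i = n + 1 := ⟨i - 1, by omega⟩
  have hr := isRule_greedyDigit hQ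
  have hb := branch_one_switchRight_mem hQ
  have hV := greedyMap_iterate_mem_survivor
    ((switchRight_mem_survivor_iff hQ hlt).2 (not_exceedsAlpha_of_le hle)) 1
  rw [Function.iterate_one, greedyMap_switchRight hlt] at hV
  have hv := value_shift_succ hQ (mu Q) n
  rw [he, value_alpha hQ] at hv
  have hd : mu Q n = 0 := by
    refine (fin_two _).resolve_right fun h0 => ?_
    obtain ⟨m, rfl⟩ : ∃ m, n = m + 1 := by
      refine ⟨n - 1, ?_⟩
      rcases n.eq_zero_or_pos with rfl | hn
      · rw [mu_zero hQ] at h0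
        exact absurd h0 (by decide)
      · omega
    have h1 := hle (m + 1) (by omega)
    have h2 : ∀ k, shift (m + 1) (mu Q) (k + 1) = alpha Q k := fun k => by
      rw [← he, shift_apply, shift_apply]
      congr 1
      omega
    have h3 : toLex (alpha Q) < toLex (shift (m + 1) (mu Q)) := by
      have : ∃ k, alpha Q k = 0 := by
        by_contra! hno
        have h4 := value_one_seq hQ fun k => (fin_two (alpha Q k)).resolve_left (hno k)
        rw [value_alpha hQ, branch_zero] at h4
        nlinarith [fst_mul_switchRight hQ, hQ.1]
      classical
      have hk := Nat.find_spec this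
      have hmin := fun j hj => (fin_two (alpha Q j)).resolve_left (Nat.find_min this (m := j) hj)
      refine lex_lt_iff.2 ⟨Nat.find this, fun j hj => ?_, hk, ?_⟩
      · rw [hmin j hj]
        cases j with
        | zero => exact h0.symm
        | succ j =>
          rw [h2]
          exact (hmin j (by omega)).symm
      · obtain ⟨k, hk'⟩ : ∃ k, Nat.find this = k + 1 := by
          refine ⟨Nat.find this - 1, ?_⟩
          have : Nat.find this ≠ 0 := fun h0 => by
            rw [h0, alpha_zero hQ] at hk
            exact absurd hk (by decide)
          omega
        rw [hk', h2]
        exact hmin k (by omega)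
    exact h1.not_gt h3
  rw [hd, branch_zero, branch_zero] at hv
  refine ⟨n + 1, ?_⟩
  rw [Function.iterate_succ_apply, greedyMap_switchRight hlt]
  -- The sequence μ is defined by the lazy rule, but R survives, so it also describes the greedy
  -- orbit.
  rw [mu_eq hQ, itinerary_lazy_of_mem_survivor hlt hV, value_shift_itinerary hQ hr hb] at hv
  have : Q.1 * (switchLeft Q - (greedyMap Q)^[n] (branch Q 1 (switchRight Q))) = 0 := by
    rw [greedyMap]
    linarith
  rcases mul_eq_zero.1 this with h5 | h5 <;> linarith [hQ.1]

/-! ### Intervals are expanded until they meet the switch region -/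

/-- The hypothesis on K keeps an interval that misses K inside one branch. If all images missed K,
they would be intervals in J_Q growing by a factor min(q₀, q₁) each time. K is the open hole off the
curve and {L} on it. -/
lemma exists_iterate_mem (hQ : Q ∈ admissible) {K : Set ℝ}
    (hK : ∀ u v, u < v → Disjoint (Set.Ioo u v) K → v ≤ switchLeft Q ∨ switchRight Q ≤ u)
    {u v : ℝ} (hu : 0 ≤ u) (huv : u < v) (hv : v ≤ top Q) :
    ∃ x ∈ Set.Ioo u v, ∃ n, (greedyMap Q)^[n] x ∈ K := by
  by_contra! hno
  have hp := hQ.1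
  have hq := hQ.2.1
  have hle := switchLeft_le_switchRight hQ
  have hlam := one_lt_min hQ
  have key : ∀ N : ℕ, ∃ u' v', 0 ≤ u' ∧ v' ≤ top Q ∧ min Q.1 Q.2 ^ N * (v - u) ≤ v' - u' ∧
      ∀ x ∈ Set.Ioo u' v', ∀ n, (greedyMap Q)^[n] x ∉ K := by
    intro N
    induction N with
    | zero => exact ⟨u, v, hu, hv, by simp, hno⟩
    | succ N ih =>
      obtain ⟨u', v', hu', hv', hlen, hav⟩ := ih
      have hpos : 0 < v' - u' :=
        lt_of_lt_of_le (mul_pos (pow_pos (by linarith) N) (by linarith)) hlen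
      have hdis : Disjoint (Set.Ioo u' v') K :=
        Set.disjoint_left.2 fun x hx => hav x hx 0
      rcases hK u' v' (by linarith) hdis with h | h
      · refine ⟨Q.1 * u', Q.1 * v', by positivity, ?_, ?_, fun x hx n => ?_⟩
        · nlinarith [fst_mul_switchRight hQ]
        · rw [pow_succ', mul_assoc, ← mul_sub]
          exact mul_le_mul (min_le_left _ _) hlen (mul_nonneg (by positivity) (by linarith))
            (by linarith)
        · have hx' : x / Q.1 ∈ Set.Ioo u' v' :=
            ⟨by rw [lt_div_iff₀' (by linarith)]; exact hx.1,
              by rw [div_lt_iff₀' (by linarith)]; exact hx.2⟩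
          have := hav _ hx' (n + 1)
          rwa [Function.iterate_succ_apply, greedyMap_of_le (hx'.2.le.trans h),
            mul_div_cancel₀ _ (by linarith)] at this
      · refine ⟨Q.2 * u' - 1, Q.2 * v' - 1, ?_, ?_, ?_, fun x hx n => ?_⟩
        · nlinarith [snd_mul_switchLeft hQ]
        · nlinarith [snd_mul_top hQ]
        · rw [pow_succ', mul_assoc, sub_sub_sub_cancel_right, ← mul_sub]
          exact mul_le_mul (min_le_right _ _) hlen (mul_nonneg (by positivity) (by linarith))
            (by linarith)
        · have hx' : (x + 1) / Q.2 ∈ Set.Ioo u' v' :=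
            ⟨by rw [lt_div_iff₀' (by linarith)]; linarith [hx.1],
              by rw [div_lt_iff₀' (by linarith)]; linarith [hx.2]⟩
          have := hav _ hx' (n + 1)
          rwa [Function.iterate_succ_apply, greedyMap_of_lt (by linarith [hx'.1]),
            mul_div_cancel₀ _ (by linarith), add_sub_cancel_right] at this
  have := eq_zero_of_pow_mul_le hlam (by linarith : 0 ≤ v - u) (b := top Q) fun N => by
    obtain ⟨u', v', h1, h2, h3, -⟩ := key N
    linarith
  linarith

lemma exists_notMem_survivor (hQ : Q ∈ admissible) (hlt : switchLeft Q < switchRight Q) {u v : ℝ}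
    (hu : 0 ≤ u) (huv : u < v) (hv : v ≤ top Q) : ∃ x ∈ Set.Ioo u v, x ∉ survivor Q := by
  obtain ⟨x, hx, n, hn⟩ := exists_iterate_mem hQ (K := Set.Ioo (switchLeft Q) (switchRight Q))
    (fun u v huv hd => by
      by_contra! h
      obtain ⟨y, hy1, hy2⟩ := exists_between (max_lt (lt_min huv h.2) (lt_min h.1 hlt))
      rw [max_lt_iff] at hy1
      rw [lt_min_iff] at hy2
      exact Set.disjoint_left.1 hd ⟨hy1.1, hy2.1⟩ ⟨hy1.2, hy2.2⟩) hu huv hv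
  refine ⟨x, hx, fun h => ?_⟩
  rcases h n with h | h
  · exact h.2.not_gt hn.1
  · exact h.1.not_gt hn.2

lemma exists_mem_hits_of_mem_curve (hQ : Q ∈ admissible) (hC : Q ∈ curve) {u v : ℝ}
    (hu : 0 ≤ u) (huv : u < v) (hv : v ≤ top Q) : ∃ x ∈ Set.Ioo u v, x ∈ hits Q (switchLeft Q) :=
  exists_iterate_mem hQ (K := {switchLeft Q})
    (fun u v _ hd => by
      by_contra! h
      rw [← switchLeft_eq_switchRight hC] at h
      exact Set.disjoint_left.1 hd ⟨h.2, h.1⟩ rfl) hu huv hv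

/-! ### Basic properties of the surviving sets -/

/-- T is discontinuous at L, but L < R separates the two pieces. Survival up to time n + 1 is thus a
union, over the pieces, of a closed interval intersected with the preimage of survival up to time n
under an affine map. -/
lemma isClosed_survivor (hlt : switchLeft Q < switchRight Q) : IsClosed (survivor Q) := by
  let S := Set.Icc 0 (switchLeft Q) ∪ Set.Icc (switchRight Q) (top Q)
  have key : ∀ n, IsClosed {x | ∀ k < n, (greedyMap Q)^[k] x ∈ S} := by
    intro n
    induction n with
    | zero => simp
    | succ n ih =>
      have h1 := (isClosed_Icc (a := 0) (b := switchLeft Q)).inter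
        (ih.preimage (f := fun x => Q.1 * x) (by fun_prop))
      have h2 := (isClosed_Icc (a := switchRight Q) (b := top Q)).inter
        (ih.preimage (f := fun x => Q.2 * x - 1) (by fun_prop))
      convert h1.union h2 using 1
      ext x
      simp only [Set.mem_ofPred_eq, Set.mem_union, Set.mem_inter_iff, Set.mem_preimage]
      have hsucc : (∀ k < n + 1, (greedyMap Q)^[k] x ∈ S) ↔
          x ∈ S ∧ ∀ k < n, (greedyMap Q)^[k] (greedyMap Q x) ∈ S := by
        constructor
        · exact fun h => ⟨h 0 (by omega), fun k hk => h (k + 1) (by omega)⟩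
        · rintro ⟨h0, h⟩ k hk
          cases k with
          | zero => exact h0
          | succ k => exact h k (by omega)
      rw [hsucc]
      constructor
      · rintro ⟨h | h, h'⟩
        · rw [greedyMap_of_le h.2] at h'
          exact .inl ⟨h, h'⟩
        · rw [greedyMap_of_lt (hlt.trans_le h.1)] at h'
          exact .inr ⟨h, h'⟩
      · rintro (⟨h, h'⟩ | ⟨h, h'⟩)
        · rw [greedyMap_of_le h.2]
          exact ⟨.inl h, h'⟩
        · rw [greedyMap_of_lt (hlt.trans_le h.1)]
          exact ⟨.inr h, h'⟩
  have : survivor Q = ⋂ n, {x | ∀ k < n, (greedyMap Q)^[k] x ∈ S} := by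
    ext x
    simp only [Set.mem_iInter, Set.mem_ofPred_eq]
    exact ⟨fun h n k _ => h k, fun h n => h (n + 1) n (by omega)⟩
  rw [this]
  exact isClosed_iInter key

lemma mem_strictSurvivor_iff (hQ : Q ∈ admissible) {x : ℝ} : x ∈ strictSurvivor Q ↔
    x ∈ survivor Q ∧ x ∉ hits Q (switchLeft Q) ∧ x ∉ hits Q (switchRight Q) := by
  constructor
  · intro h
    have hle := switchLeft_le_switchRight hQ
    refine ⟨strictSurvivor_subset h, ?_, ?_⟩
    · rintro ⟨n, hn⟩
      rcases h n with h | h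
      · exact h.2.ne hn
      · linarith [h.1]
    · rintro ⟨n, hn⟩
      rcases h n with h | h
      · linarith [h.2]
      · exact h.1.ne' hn
  · rintro ⟨h, h1, h2⟩ n
    rcases h n with h | h
    · exact .inl ⟨h.1, lt_of_le_of_ne h.2 fun he => h1 ⟨n, he⟩⟩
    · exact .inr ⟨lt_of_le_of_ne h.1 fun he => h2 ⟨n, he.symm⟩, h.2⟩

lemma survivor_diff_strictSurvivor (hQ : Q ∈ admissible) : survivor Q \ strictSurvivor Q =
    survivor Q ∩ (hits Q (switchLeft Q) ∪ hits Q (switchRight Q)) := by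
  ext x
  rw [Set.mem_sdiff, mem_strictSurvivor_iff hQ, Set.mem_inter_iff, Set.mem_union]
  tauto

lemma greedyMap_eq (x : ℝ) : greedyMap Q x = Q.1 * x ∨ greedyMap Q x = Q.2 * x - 1 :=
  (le_or_gt x (switchLeft Q)).imp greedyMap_of_le greedyMap_of_lt

lemma countable_hits (hQ : Q ∈ admissible) (a : ℝ) : (hits Q a).Countable := by
  have hp := hQ.1
  have hq := hQ.2.1
  have key : ∀ n, {x | (greedyMap Q)^[n] x = a}.Countable := by
    intro n
    induction n with
    | zero => simp
    | succ n ih =>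
      refine ((ih.image fun y => y / Q.1).union (ih.image fun y => (y + 1) / Q.2)).mono ?_
      intro x hx
      rw [Set.mem_ofPred_eq, Function.iterate_succ_apply] at hx
      rcases greedyMap_eq x with h | h
      · rw [h] at hx
        exact .inl ⟨_, hx, by field_simp⟩
      · rw [h] at hx
        exact .inr ⟨_, hx, by field_simp; ring⟩
  have : hits Q a = ⋃ n, {x | (greedyMap Q)^[n] x = a} := by
    ext x
    simp [hits]
  rw [this]
  exact Set.countable_iUnion key

lemma countable_survivor_diff (hQ : Q ∈ admissible) :
    (survivor Q \ strictSurvivor Q).Countable := by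
  rw [survivor_diff_strictSurvivor hQ]
  exact ((countable_hits hQ _).union (countable_hits hQ _)).mono Set.inter_subset_right

lemma zero_mem_strictSurvivor (hQ : Q ∈ admissible) : (0 : ℝ) ∈ strictSurvivor Q := by
  have h0 : greedyMap Q 0 = 0 := by
    rw [greedyMap_of_le (switchLeft_pos hQ).le, mul_zero]
  intro n
  rw [Function.iterate_fixed h0]
  exact .inl ⟨le_rfl, switchLeft_pos hQ⟩

lemma greedyMap_mem_survivor {x : ℝ} (h : x ∈ survivor Q) : greedyMap Q x ∈ survivor Q :=
  greedyMap_iterate_mem_survivor h 1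

lemma mem_hits_of_greedyMap_mem {a x : ℝ} (h : greedyMap Q x ∈ hits Q a) : x ∈ hits Q a := by
  obtain ⟨n, hn⟩ := h
  exact ⟨n + 1, hn⟩

lemma self_mem_hits (a : ℝ) : a ∈ hits Q a := ⟨0, rfl⟩

/-- A point that hits both `a` and `b` makes one of them hit the other. -/
lemma mem_hits_or_mem_hits {a b x : ℝ} (ha : x ∈ hits Q a) (hb : x ∈ hits Q b) :
    a ∈ hits Q b ∨ b ∈ hits Q a := by
  obtain ⟨n, rfl⟩ := ha
  obtain ⟨m, rfl⟩ := hb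
  rcases le_total n m with h | h
  · exact .inl ⟨m - n, by rw [← Function.iterate_add_apply, Nat.sub_add_cancel h]⟩
  · exact .inr ⟨n - m, by rw [← Function.iterate_add_apply, Nat.sub_add_cancel h]⟩

lemma mem_hits_trans {a b x : ℝ} (hx : x ∈ hits Q a) (hab : a ∈ hits Q b) : x ∈ hits Q b := by
  obtain ⟨n, rfl⟩ := hx
  obtain ⟨m, rfl⟩ := hab
  exact ⟨m + n, by rw [Function.iterate_add_apply]⟩

/-! ### Gaps of the surviving set -/

lemma survivor_cases {x : ℝ} (hx : x ∈ survivor Q) :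
    (0 ≤ x ∧ x ≤ switchLeft Q) ∨ (switchRight Q ≤ x ∧ x ≤ top Q) := hx 0

lemma div_fst_mem_survivor (hQ : Q ∈ admissible) {y : ℝ} (hy : y ∈ survivor Q)
    (h : y / Q.1 ≤ switchLeft Q) : y / Q.1 ∈ survivor Q := by
  have hp := hQ.1
  refine mem_survivor_of_greedyMap_mem
    (.inl ⟨div_nonneg (survivor_subset hQ hy).1 (by linarith), h⟩) ?_
  rwa [greedyMap_of_le h, mul_div_cancel₀ _ (by linarith)]

lemma div_snd_mem_survivor (hQ : Q ∈ admissible) (hlt : switchLeft Q < switchRight Q) {y : ℝ}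
    (hy : y ∈ survivor Q) (h : switchRight Q ≤ (y + 1) / Q.2) : (y + 1) / Q.2 ∈ survivor Q := by
  have hq := hQ.2.1
  refine mem_survivor_of_greedyMap_mem (.inr ⟨h, ?_⟩) ?_
  · rw [div_le_iff₀' (by linarith), snd_mul_top hQ]
    linarith [(survivor_subset hQ hy).2]
  · rwa [greedyMap_of_lt (hlt.trans_le h), mul_div_cancel₀ _ (by linarith), add_sub_cancel_right]

/-- The right endpoint of a gap of the surviving set hits `switchRight`. -/
lemma gap_right_mem_hits (hQ : Q ∈ admissible) (hlt : switchLeft Q < switchRight Q)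
    (hR : switchRight Q ∈ survivor Q) (n : ℕ) {p b : ℝ} (hp0 : 0 ≤ p)
    (hn : (greedyMap Q)^[n] p ∈ Set.Ioo (switchLeft Q) (switchRight Q)) (hb : b ∈ survivor Q)
    (hpb : p < b) (hgap : ∀ y ∈ survivor Q, p ≤ y → ¬ y < b) : b ∈ hits Q (switchRight Q) := by
  have hp := hQ.1
  have hq := hQ.2.1
  -- Since R survives, a gap from p to b that contains or ends at R must end there.
  have hR' : p ≤ switchRight Q → switchRight Q ≤ b → b ∈ hits Q (switchRight Q) := fun h1 h2 => by
    rw [le_antisymm (not_lt.1 (hgap _ hR h1)) h2]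
    exact self_mem_hits _
  induction n generalizing p b with
  | zero =>
    rw [Function.iterate_zero_apply] at hn
    rcases survivor_cases hb with h | h
    · linarith [hn.1, h.2]
    · exact hR' hn.2.le h.1
  -- Otherwise p and b lie on the same branch. A survivor in the image gap would pull back to one
  -- between p and b, so the image is again a gap, whose left point enters the hole one step sooner.
  | succ n ih =>
    rcases survivor_cases hb with h | h
    · have hpl : p ≤ switchLeft Q := by linarith
      refine mem_hits_of_greedyMap_mem ?_
      rw [Function.iterate_succ_apply, greedyMap_of_le hpl] at hn
      have hTb := greedyMap_mem_survivor hb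
      rw [greedyMap_of_le h.2] at hTb ⊢
      have hgap' : ∀ y ∈ survivor Q, Q.1 * p ≤ y → ¬ y < Q.1 * b := fun y hy h1 h2 => by
        have h3 : y / Q.1 < b := by rwa [div_lt_iff₀' (by linarith)]
        exact hgap _ (div_fst_mem_survivor hQ hy (by linarith))
          (by rwa [le_div_iff₀' (by linarith)]) h3
      have hpb' : Q.1 * p < Q.1 * b := by nlinarith
      refine ih (by positivity) hn hTb hpb' hgap' fun h1 h2 => ?_
      rw [le_antisymm (not_lt.1 (hgap' _ hR h1)) h2]
      exact self_mem_hits _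
    · rcases le_or_gt p (switchRight Q) with hpr | hpr
      · exact hR' hpr h.1
      · refine mem_hits_of_greedyMap_mem ?_
        rw [Function.iterate_succ_apply, greedyMap_of_lt (hlt.trans hpr)] at hn
        have hTb := greedyMap_mem_survivor hb
        rw [greedyMap_of_lt (hlt.trans_le h.1)] at hTb ⊢
        have hgap' : ∀ y ∈ survivor Q, Q.2 * p - 1 ≤ y → ¬ y < Q.2 * b - 1 := fun y hy h1 h2 => by
          have h3 : (y + 1) / Q.2 < b := by
            rw [div_lt_iff₀' (by linarith)]
            linarith
          have h4 : p ≤ (y + 1) / Q.2 := by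
            rw [le_div_iff₀' (by linarith)]
            linarith
          exact hgap _ (div_snd_mem_survivor hQ hlt hy (by linarith)) h4 h3
        have hpb' : Q.2 * p - 1 < Q.2 * b - 1 := by nlinarith
        refine ih ?_ hn hTb hpb' hgap' fun h1 h2 => ?_
        · nlinarith [snd_mul_switchLeft hQ]
        rw [le_antisymm (not_lt.1 (hgap' _ hR h1)) h2]
        exact self_mem_hits _

/-- The left endpoint of a gap of the surviving set hits `switchLeft`. -/
lemma gap_left_mem_hits (hQ : Q ∈ admissible) (hlt : switchLeft Q < switchRight Q)
    (hL : switchLeft Q ∈ survivor Q) (n : ℕ) {a p : ℝ} (hp0 : p ≤ top Q)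
    (hn : (greedyMap Q)^[n] p ∈ Set.Ioo (switchLeft Q) (switchRight Q)) (ha : a ∈ survivor Q)
    (hap : a < p) (hgap : ∀ y ∈ survivor Q, y ≤ p → ¬ a < y) : a ∈ hits Q (switchLeft Q) := by
  have hp := hQ.1
  have hq := hQ.2.1
  have hL' : switchLeft Q ≤ p → a ≤ switchLeft Q → a ∈ hits Q (switchLeft Q) := fun h1 h2 => by
    rw [le_antisymm h2 (not_lt.1 (hgap _ hL h1))]
    exact self_mem_hits _
  induction n generalizing p a with
  | zero =>
    rw [Function.iterate_zero_apply] at hn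
    rcases survivor_cases ha with h | h
    · exact hL' hn.1.le h.2
    · linarith [hn.2, h.1]
  | succ n ih =>
    rcases survivor_cases ha with h | h
    · rcases le_or_gt (switchLeft Q) p with hpr | hpr
      · exact hL' hpr h.2
      · refine mem_hits_of_greedyMap_mem ?_
        rw [Function.iterate_succ_apply, greedyMap_of_le hpr.le] at hn
        have hTa := greedyMap_mem_survivor ha
        rw [greedyMap_of_le h.2] at hTa ⊢
        have hgap' : ∀ y ∈ survivor Q, y ≤ Q.1 * p → ¬ Q.1 * a < y := fun y hy h1 h2 => by
          have h3 : y / Q.1 ≤ p := by rwa [div_le_iff₀' (by linarith)]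
          exact hgap _ (div_fst_mem_survivor hQ hy (by linarith)) h3
            (by rwa [lt_div_iff₀' (by linarith)])
        have hap' : Q.1 * a < Q.1 * p := by nlinarith
        refine ih ?_ hn hTa hap' hgap' fun h1 h2 => ?_
        · nlinarith [fst_mul_switchRight hQ]
        rw [le_antisymm h2 (not_lt.1 (hgap' _ hL h1))]
        exact self_mem_hits _
    · have hpl : switchRight Q ≤ p := by linarith
      refine mem_hits_of_greedyMap_mem ?_
      rw [Function.iterate_succ_apply, greedyMap_of_lt (hlt.trans_le hpl)] at hn
      have hTa := greedyMap_mem_survivor ha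
      rw [greedyMap_of_lt (hlt.trans_le h.1)] at hTa ⊢
      have hgap' : ∀ y ∈ survivor Q, y ≤ Q.2 * p - 1 → ¬ Q.2 * a - 1 < y := fun y hy h1 h2 => by
        have h3 : (y + 1) / Q.2 ≤ p := by
          rw [div_le_iff₀' (by linarith)]
          linarith
        have h4 : a < (y + 1) / Q.2 := by
          rw [lt_div_iff₀' (by linarith)]
          linarith
        exact hgap _ (div_snd_mem_survivor hQ hlt hy (by linarith)) h3 h4
      have hap' : Q.2 * a - 1 < Q.2 * p - 1 := by nlinarith
      refine ih ?_ hn hTa hap' hgap' fun h1 h2 => ?_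
      · nlinarith [snd_mul_top hQ]
      rw [le_antisymm h2 (not_lt.1 (hgap' _ hL h1))]
      exact self_mem_hits _

lemma exists_iterate_mem_Ioo (hQ : Q ∈ admissible) {p : ℝ} (hp : p ∈ Set.Icc 0 (top Q))
    (hV : p ∉ survivor Q) :
    ∃ n, (greedyMap Q)^[n] p ∈ Set.Ioo (switchLeft Q) (switchRight Q) := by
  by_contra! hno
  refine hV fun n => ?_
  have hI : (greedyMap Q)^[n] p ∈ _ := iterate_step_mem_Icc hQ (isRule_greedyDigit hQ) hp n
  rcases le_or_gt ((greedyMap Q)^[n] p) (switchLeft Q) with h | h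
  · exact .inl ⟨hI.1, h⟩
  · exact .inr ⟨not_lt.1 fun h' => hno n ⟨h, h'⟩, hI.2⟩

/-- Between u and x there is a point p outside 𝒱; the first point of 𝒱 to the right of p ends a gap,
hence hits R. -/
lemma exists_mem_hits_right (hQ : Q ∈ admissible) (hlt : switchLeft Q < switchRight Q)
    (hR : switchRight Q ∈ survivor Q) {u x : ℝ} (hu : 0 ≤ u) (hux : u < x) (hx : x ∈ survivor Q) :
    ∃ y ∈ survivor Q ∩ hits Q (switchRight Q), u < y ∧ y ≤ x := by
  have hxt := (survivor_subset hQ hx).2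
  obtain ⟨p, ⟨hup, hpx⟩, hp⟩ := exists_notMem_survivor hQ hlt hu hux hxt
  obtain ⟨n, hn⟩ := exists_iterate_mem_Ioo hQ ⟨by linarith, by linarith⟩ hp
  obtain ⟨b, ⟨⟨hb1, hb2⟩, hbV⟩, hmin⟩ := (isCompact_Icc.inter_right
    (isClosed_survivor hlt)).exists_isLeast ⟨x, ⟨hpx.le, le_rfl⟩, hx⟩
  have hpb : p < b := lt_of_le_of_ne hb1 fun h => hp (h ▸ hbV)
  refine ⟨b, ⟨hbV, gap_right_mem_hits hQ hlt hR n (by linarith) hn hbV hpb fun y hy h1 h2 => ?_⟩,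
    by linarith, hb2⟩
  exact (hmin ⟨⟨h1, by linarith⟩, hy⟩).not_gt h2

lemma exists_mem_hits_left (hQ : Q ∈ admissible) (hlt : switchLeft Q < switchRight Q)
    (hL : switchLeft Q ∈ survivor Q) {x v : ℝ} (hv : v ≤ top Q) (hxv : x < v)
    (hx : x ∈ survivor Q) : ∃ y ∈ survivor Q ∩ hits Q (switchLeft Q), x ≤ y ∧ y < v := by
  have hxt := (survivor_subset hQ hx).1
  obtain ⟨p, ⟨hxp, hpv⟩, hp⟩ := exists_notMem_survivor hQ hlt hxt hxv hv
  obtain ⟨n, hn⟩ := exists_iterate_mem_Ioo hQ ⟨by linarith, by linarith⟩ hp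
  obtain ⟨a, ⟨⟨ha1, ha2⟩, haV⟩, hmax⟩ := (isCompact_Icc.inter_right
    (isClosed_survivor hlt)).exists_isGreatest ⟨x, ⟨le_rfl, hxp.le⟩, hx⟩
  have hap : a < p := lt_of_le_of_ne ha2 fun h => hp (h ▸ haV)
  refine ⟨a, ⟨haV, gap_left_mem_hits hQ hlt hL n (by linarith) hn haV hap fun y hy h1 h2 => ?_⟩,
    ha1, by linarith⟩
  exact (hmax ⟨⟨by linarith, h1⟩, hy⟩).not_gt h2

/-- A surviving point that hits `switchRight` is isolated from the left. -/
lemma exists_gap_left (hQ : Q ∈ admissible) (hlt : switchLeft Q < switchRight Q) {b : ℝ}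
    (hb : b ∈ survivor Q) (hh : b ∈ hits Q (switchRight Q)) :
    ∃ ε > 0, ∀ y ∈ survivor Q, b - ε < y → ¬ y < b := by
  have hp := hQ.1
  have hq := hQ.2.1
  have hR : ∃ ε > 0, ∀ y ∈ survivor Q, switchRight Q - ε < y → ¬ y < switchRight Q := by
    refine ⟨switchRight Q - switchLeft Q, by linarith, fun y hy h1 h2 => ?_⟩
    rcases survivor_cases hy with h | h <;> linarith
  obtain ⟨n, hn⟩ := hh
  induction n generalizing b with
  | zero => rwa [show b = switchRight Q from hn]
  | succ n ih =>
    rw [Function.iterate_succ_apply] at hn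
    obtain ⟨ε, hε, hgap⟩ := ih (greedyMap_mem_survivor hb) hn
    rcases survivor_cases hb with h | h
    · refine ⟨ε / Q.1, by positivity, fun y hy h1 h2 => ?_⟩
      have h3 := greedyMap_mem_survivor hy
      rw [greedyMap_of_le (by linarith)] at h3
      rw [greedyMap_of_le h.2] at hgap
      rw [sub_lt_comm, lt_div_iff₀' (by linarith)] at h1
      exact hgap _ h3 (by nlinarith) (by nlinarith)
    · rcases h.1.eq_or_lt with he | hne
      · rwa [← he]
      -- The second bound keeps the neighbours of b to the right of R, on the same branch as b.
      · refine ⟨min (ε / Q.2) (b - switchRight Q), lt_min (by positivity) (by linarith),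
          fun y hy h1 h2 => ?_⟩
        rw [sub_lt_comm, lt_min_iff] at h1
        have h3 := greedyMap_mem_survivor hy
        rw [greedyMap_of_lt (by linarith)] at h3
        rw [greedyMap_of_lt (by linarith)] at hgap
        have h4 := h1.1
        rw [lt_div_iff₀' (by linarith)] at h4
        exact hgap _ h3 (by nlinarith) (by nlinarith)

/-- A surviving point that hits `switchLeft` is isolated from the right. -/
lemma exists_gap_right (hQ : Q ∈ admissible) (hlt : switchLeft Q < switchRight Q) {a : ℝ}
    (ha : a ∈ survivor Q) (hh : a ∈ hits Q (switchLeft Q)) :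
    ∃ ε > 0, ∀ y ∈ survivor Q, a < y → ¬ y < a + ε := by
  have hp := hQ.1
  have hq := hQ.2.1
  have hL : ∃ ε > 0, ∀ y ∈ survivor Q, switchLeft Q < y → ¬ y < switchLeft Q + ε := by
    refine ⟨switchRight Q - switchLeft Q, by linarith, fun y hy h1 h2 => ?_⟩
    rcases survivor_cases hy with h | h <;> linarith
  obtain ⟨n, hn⟩ := hh
  induction n generalizing a with
  | zero => rwa [show a = switchLeft Q from hn]
  | succ n ih =>
    rw [Function.iterate_succ_apply] at hn
    obtain ⟨ε, hε, hgap⟩ := ih (greedyMap_mem_survivor ha) hn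
    rcases survivor_cases ha with h | h
    · rcases h.2.eq_or_lt with he | hne
      · rwa [he]
      · refine ⟨min (ε / Q.1) (switchLeft Q - a), lt_min (by positivity) (by linarith),
          fun y hy h1 h2 => ?_⟩
        rw [← sub_lt_iff_lt_add', lt_min_iff] at h2
        have h3 := greedyMap_mem_survivor hy
        rw [greedyMap_of_le (by linarith)] at h3
        rw [greedyMap_of_le (by linarith)] at hgap
        have h4 := h2.1
        rw [lt_div_iff₀' (by linarith)] at h4
        exact hgap _ h3 (by nlinarith) (by nlinarith)
    · refine ⟨ε / Q.2, by positivity, fun y hy h1 h2 => ?_⟩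
      have h3 := greedyMap_mem_survivor hy
      rw [greedyMap_of_lt (by linarith)] at h3
      rw [greedyMap_of_lt (by linarith)] at hgap
      rw [← sub_lt_iff_lt_add', lt_div_iff₀' (by linarith)] at h2
      exact hgap _ h3 (by nlinarith) (by nlinarith)

/-- If `switchRight` survives, surviving points accumulate at `0`. -/
lemma exists_survivor_near_zero (hQ : Q ∈ admissible) (hlt : switchLeft Q < switchRight Q)
    (hR : switchRight Q ∈ survivor Q) {ε : ℝ} (hε : 0 < ε) : ∃ y ∈ survivor Q, 0 < y ∧ y < ε := by
  have hp := hQ.1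
  have hq := hQ.2.1
  obtain ⟨y, hy, hy0, hyl⟩ : ∃ y ∈ survivor Q, 0 < y ∧ y ≤ switchLeft Q := by
    have h := greedyMap_mem_survivor hR
    rw [greedyMap_of_lt hlt] at h
    -- The image of R is positive because L < R. It is less than R, since R lies below the fixed
    -- point of q₁x - 1, so survival puts it in [0, L]. Repeated division by q₀ then gives survivors
    -- tending to 0.
    refine ⟨_, h, by nlinarith [snd_mul_switchLeft hQ], ?_⟩
    rcases survivor_cases h with h1 | h1
    · exact h1.2
    · nlinarith [snd_mul_top hQ, switchRight_lt_top hQ]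
  have key : ∀ n : ℕ, ∃ z ∈ survivor Q, 0 < z ∧ z ≤ switchLeft Q ∧ Q.1 ^ n * z ≤ y := by
    intro n
    induction n with
    | zero => exact ⟨y, hy, hy0, hyl, by simp⟩
    | succ n ih =>
      obtain ⟨z, hz, hz0, hzl, hzy⟩ := ih
      have h1 : z / Q.1 ≤ switchLeft Q := (div_le_self hz0.le hp.le).trans hzl
      refine ⟨z / Q.1, div_fst_mem_survivor hQ hz h1, by positivity, h1, ?_⟩
      rwa [pow_succ, mul_assoc, mul_div_cancel₀ _ (by linarith)]
  obtain ⟨n, hn⟩ := pow_unbounded_of_one_lt (y / ε) hp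
  obtain ⟨z, hz, hz0, -, hzy⟩ := key n
  refine ⟨z, hz, hz0, ?_⟩
  rw [div_lt_iff₀ hε] at hn
  exact lt_of_mul_lt_mul_left (by linarith : Q.1 ^ n * z < Q.1 ^ n * ε) (by positivity)

/-- If `switchLeft` survives, surviving points accumulate at the right endpoint of `J_Q`. -/
lemma exists_survivor_near_top (hQ : Q ∈ admissible) (hlt : switchLeft Q < switchRight Q)
    (hL : switchLeft Q ∈ survivor Q) {ε : ℝ} (hε : 0 < ε) :
    ∃ y ∈ survivor Q, y < top Q ∧ top Q - ε < y := by
  have hp := hQ.1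
  have hq := hQ.2.1
  have hqt := snd_mul_top hQ
  obtain ⟨y, hy, hy0, hyl⟩ : ∃ y ∈ survivor Q, y < top Q ∧ switchRight Q ≤ y := by
    have h := greedyMap_mem_survivor hL
    rw [greedyMap_of_le le_rfl] at h
    refine ⟨_, h, by nlinarith [fst_mul_switchRight hQ], ?_⟩
    rcases survivor_cases h with h1 | h1
    · nlinarith [switchLeft_pos hQ]
    · exact h1.1
  have key : ∀ n : ℕ, ∃ z ∈ survivor Q, z < top Q ∧ switchRight Q ≤ z ∧
      Q.2 ^ n * (top Q - z) ≤ top Q - y := by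
    intro n
    induction n with
    | zero => exact ⟨y, hy, hy0, hyl, by simp⟩
    | succ n ih =>
      obtain ⟨z, hz, hz0, hzl, hzy⟩ := ih
      have h1 : switchRight Q ≤ (z + 1) / Q.2 := by
        rw [le_div_iff₀' (by linarith)]
        nlinarith [switchRight_lt_top hQ]
      have h2 : Q.2 * (top Q - (z + 1) / Q.2) = top Q - z := by
        rw [mul_sub, hqt]
        field_simp
        ring
      refine ⟨(z + 1) / Q.2, div_snd_mem_survivor hQ hlt hz h1, ?_, h1, ?_⟩
      · rw [div_lt_iff₀' (by linarith)]
        linarith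
      · rwa [pow_succ, mul_assoc, h2]
  obtain ⟨n, hn⟩ := pow_unbounded_of_one_lt ((top Q - y) / ε) hq
  obtain ⟨z, hz, hz0, -, hzy⟩ := key n
  refine ⟨z, hz, hz0, ?_⟩
  rw [div_lt_iff₀ hε] at hn
  have := lt_of_mul_lt_mul_left (by linarith : Q.2 ^ n * (top Q - z) < Q.2 ^ n * ε) (by positivity)
  linarith

/-! ### Accumulation points -/

lemma accPt_principal_iff {S : Set ℝ} {x : ℝ} :
    AccPt x (Filter.principal S) ↔ ∀ ε > 0, ∃ y ∈ S, y ≠ x ∧ |y - x| < ε := by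
  rw [accPt_iff_nhds]
  constructor
  · intro h ε hε
    obtain ⟨y, ⟨h1, h2⟩, h3⟩ := h _ (Metric.ball_mem_nhds x hε)
    exact ⟨y, h2, h3, h1⟩
  · intro h U hU
    obtain ⟨ε, hε, hsub⟩ := Metric.mem_nhds_iff.1 hU
    obtain ⟨y, h1, h2, h3⟩ := h ε hε
    exact ⟨y, ⟨hsub h3, h1⟩, h2⟩

lemma isDiscrete_iff_not_accPt {S : Set ℝ} :
    IsDiscrete S ↔ ∀ x ∈ S, ¬ AccPt x (Filter.principal S) := by
  simp [isDiscrete_iff_nhdsNE, AccPt]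

lemma mem_closure_iff_mem_or_accPt {S : Set ℝ} {x : ℝ} :
    x ∈ closure S ↔ x ∈ S ∨ AccPt x (Filter.principal S) := by
  rw [closure_eq_self_union_derivedSet]
  rfl

lemma accPt_mono {S T : Set ℝ} {x : ℝ} (h : AccPt x (Filter.principal S)) (hST : S ⊆ T) :
    AccPt x (Filter.principal T) := h.mono (Filter.principal_mono.2 hST)

/-- Removing a countable set from a closed set without isolated points leaves a dense subset. -/
lemma subset_closure_diff_of_countable {S D : Set ℝ} (hS : IsClosed S)
    (hacc : ∀ x ∈ S, AccPt x (Filter.principal S)) (hD : D.Countable) : S ⊆ closure (S \ D) := by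
  intro x hx
  rw [Metric.mem_closure_iff]
  intro ε hε
  have hperf : Perfect S := ⟨hS, hacc⟩
  obtain ⟨h1, h2⟩ := hperf.closure_nhds_inter x hx (Metric.mem_ball_self (half_pos hε))
    Metric.isOpen_ball
  -- The piece of S near x is perfect after closure, so it contains an injective image of the Cantor
  -- space, which is uncountable. Half the radius absorbs the closure.
  have hsub : closure (Metric.ball x (ε / 2) ∩ S) ⊆ Metric.closedBall x (ε / 2) ∩ S :=
    closure_minimal (Set.inter_subset_inter_left _ Metric.ball_subset_closedBall)
      (Metric.isClosed_closedBall.inter hS)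
  obtain ⟨f, hf, -, hinj⟩ := h1.exists_nat_bool_injection h2
  have hunc : ¬ (Set.range f).Countable := fun hc => by
    have h3 : Countable (ℕ → Bool) := by
      rw [← Set.countable_univ_iff]
      exact Set.countable_of_injective_of_countable_image hinj.injOn (by rwa [Set.image_univ])
    have h4 := Cardinal.mk_le_aleph0_iff.2 h3
    simp only [Cardinal.mk_pi, Cardinal.mk_bool, Cardinal.prod_const, Cardinal.lift_id,
      Cardinal.mk_nat] at h4
    exact (Cardinal.cantor _).not_ge h4
  obtain ⟨y, hy, hyD⟩ : ∃ y ∈ Set.range f, y ∉ D := by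
    by_contra! hno
    exact hunc (hD.mono hno)
  obtain ⟨h5, h6⟩ := hsub (hf hy)
  refine ⟨y, ⟨h6, hyD⟩, ?_⟩
  rw [dist_comm]
  exact lt_of_le_of_lt h5 (half_lt_self hε)

/-! ### Accumulation of the preimages of the endpoints of the switch region -/

lemma accPt_hits_right (hQ : Q ∈ admissible) (hlt : switchLeft Q < switchRight Q)
    (hR : switchRight Q ∈ survivor Q) {x : ℝ} (hx : x ∈ survivor Q)
    (hh : x ∉ hits Q (switchRight Q)) :
    AccPt x (Filter.principal (survivor Q ∩ hits Q (switchRight Q))) := by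
  refine accPt_principal_iff.2 fun ε hε => ?_
  rcases (survivor_subset hQ hx).1.eq_or_lt with rfl | h0
  -- The point 0 has nothing to its left in J_Q and must be approached from the right.
  · obtain ⟨y, hy, hy0, hyε⟩ := exists_survivor_near_zero hQ hlt hR hε
    obtain ⟨z, hz, hz0, hzy⟩ := exists_mem_hits_right hQ hlt hR le_rfl hy0 hy
    refine ⟨z, hz, hz0.ne', ?_⟩
    rw [abs_of_pos] <;> linarith
  · obtain ⟨z, hz, hz0, hzx⟩ := exists_mem_hits_right hQ hlt hR (le_max_left 0 (x - ε))
      (max_lt h0 (by linarith)) hx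
    refine ⟨z, hz, fun he => hh (he ▸ hz.2), ?_⟩
    rw [max_lt_iff] at hz0
    rw [abs_lt]
    constructor <;> linarith [hz0.2]

lemma accPt_hits_left (hQ : Q ∈ admissible) (hlt : switchLeft Q < switchRight Q)
    (hL : switchLeft Q ∈ survivor Q) {x : ℝ} (hx : x ∈ survivor Q)
    (hh : x ∉ hits Q (switchLeft Q)) :
    AccPt x (Filter.principal (survivor Q ∩ hits Q (switchLeft Q))) := by
  refine accPt_principal_iff.2 fun ε hε => ?_
  rcases (survivor_subset hQ hx).2.eq_or_lt with rfl | h0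
  · obtain ⟨y, hy, hy0, hyε⟩ := exists_survivor_near_top hQ hlt hL hε
    obtain ⟨z, hz, hz0, hzy⟩ := exists_mem_hits_left hQ hlt hL le_rfl hy0 hy
    refine ⟨z, hz, hzy.ne, ?_⟩
    rw [abs_lt]
    constructor <;> linarith
  · obtain ⟨z, hz, hz0, hzx⟩ := exists_mem_hits_left hQ hlt hL (min_le_left (top Q) (x + ε))
      (lt_min h0 (by linarith)) hx
    refine ⟨z, hz, fun he => hh (he ▸ hz.2), ?_⟩
    rw [lt_min_iff] at hzx
    rw [abs_lt]
    constructor <;> linarith [hzx.2]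

/-- `a` is an endpoint of the switch region. -/
def IsEndpoint (Q : ℝ × ℝ) (a : ℝ) : Prop := a = switchLeft Q ∨ a = switchRight Q

/-- `a` and `b` are the two endpoints of the switch region, in some order. -/
def AreEndpoints (Q : ℝ × ℝ) (a b : ℝ) : Prop :=
  a = switchLeft Q ∧ b = switchRight Q ∨ a = switchRight Q ∧ b = switchLeft Q

lemma accPt_hits (hQ : Q ∈ admissible) (hlt : switchLeft Q < switchRight Q) {a : ℝ}
    (ha : IsEndpoint Q a) (haV : a ∈ survivor Q) {x : ℝ} (hx : x ∈ survivor Q)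
    (hh : x ∉ hits Q a) : AccPt x (Filter.principal (survivor Q ∩ hits Q a)) := by
  rcases ha with rfl | rfl
  · exact accPt_hits_left hQ hlt haV hx hh
  · exact accPt_hits_right hQ hlt haV hx hh

/-- A surviving point that hits both endpoints of the switch region is isolated. -/
lemma not_accPt_of_hits (hQ : Q ∈ admissible) (hlt : switchLeft Q < switchRight Q) {x : ℝ}
    (hx : x ∈ survivor Q) (hL : x ∈ hits Q (switchLeft Q)) (hR : x ∈ hits Q (switchRight Q)) :
    ¬ AccPt x (Filter.principal (survivor Q)) := by
  obtain ⟨ε, hε, h1⟩ := exists_gap_left hQ hlt hx hR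
  obtain ⟨ε', hε', h2⟩ := exists_gap_right hQ hlt hx hL
  rw [accPt_principal_iff]
  intro h
  obtain ⟨y, hy, hne, hlt⟩ := h (min ε ε') (lt_min hε hε')
  rw [lt_min_iff, abs_lt, abs_lt] at hlt
  rcases lt_or_gt_of_ne hne with h | h
  · exact h1 y hy (by linarith [hlt.1.1]) h
  · exact h2 y hy h (by linarith [hlt.2.2])

lemma subset_closure_survivor_diff (hQ : Q ∈ admissible) (hlt : switchLeft Q < switchRight Q)
    {a : ℝ} (ha : IsEndpoint Q a) (haV : a ∈ survivor Q) :
    survivor Q ⊆ closure (survivor Q \ strictSurvivor Q) := by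
  intro x hx
  have hsub : survivor Q ∩ hits Q a ⊆ survivor Q \ strictSurvivor Q := by
    rw [survivor_diff_strictSurvivor hQ]
    refine Set.inter_subset_inter_right _ ?_
    rcases ha with rfl | rfl
    · exact Set.subset_union_left
    · exact Set.subset_union_right
  by_cases hh : x ∈ hits Q a
  · exact subset_closure (hsub ⟨hx, hh⟩)
  · exact mem_closure_iff_mem_or_accPt.2 (.inr (accPt_mono (accPt_hits hQ hlt ha haV hx hh) hsub))

/-- A finite set is closed, so density would place all of 𝒱 in 𝒱 \ 𝒰, although 0 belongs to 𝒰. -/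
lemma mk_survivor_diff (hQ : Q ∈ admissible)
    (h : survivor Q ⊆ closure (survivor Q \ strictSurvivor Q)) :
    Cardinal.mk ↥(survivor Q \ strictSurvivor Q) = Cardinal.aleph0 := by
  refine le_antisymm (countable_survivor_diff hQ).le_aleph0 ?_
  rw [Cardinal.aleph0_le_mk_iff, Set.infinite_coe_iff]
  intro hfin
  have h0 := zero_mem_strictSurvivor hQ
  have h1 := h (strictSurvivor_subset h0)
  rw [hfin.isClosed.closure_eq] at h1
  exact h1.2 h0

/-! ### Local invariance -/

/-- Accumulation points are carried along by the quasi-greedy map. -/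
lemma accPt_greedyMap (hQ : Q ∈ admissible) (hlt : switchLeft Q < switchRight Q) {W : Set ℝ}
    (hWV : W ⊆ survivor Q) (hW : ∀ y ∈ W, greedyMap Q y ∈ W) {x : ℝ} (hx : x ∈ survivor Q)
    (h : AccPt x (Filter.principal W)) : AccPt (greedyMap Q x) (Filter.principal W) := by
  have hp := hQ.1
  have hq := hQ.2.1
  rw [accPt_principal_iff] at h ⊢
  intro ε hε
  -- Survivors closer than R - L lie on the same side of the hole, where T is a single affine map.
  obtain ⟨y, hy, hne, hd⟩ := h (min (min (ε / Q.1) (ε / Q.2)) (switchRight Q - switchLeft Q))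
    (by simp only [lt_min_iff]; exact ⟨⟨by positivity, by positivity⟩, by linarith⟩)
  simp only [lt_min_iff] at hd
  obtain ⟨⟨h1, h2⟩, h3⟩ := hd
  rw [lt_div_iff₀' (by linarith)] at h1 h2
  refine ⟨_, hW y hy, ?_⟩
  rw [abs_lt] at h3
  rcases survivor_cases hx with hc | hc <;> rcases survivor_cases (hWV hy) with hc' | hc'
  · rw [greedyMap_of_le hc.2, greedyMap_of_le hc'.2, ← mul_sub, abs_mul,
      abs_of_pos (by linarith : 0 < Q.1)]
    exact ⟨fun he => hne (mul_left_cancel₀ (by linarith) he), h1⟩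
  · linarith [h3.2]
  · linarith [h3.1]
  · rw [greedyMap_of_lt (by linarith), greedyMap_of_lt (by linarith), sub_sub_sub_cancel_right,
      ← mul_sub, abs_mul, abs_of_pos (by linarith : 0 < Q.2)]
    exact ⟨fun he => hne (mul_left_cancel₀ (by linarith) (sub_left_inj.1 he)), h2⟩

/-- Away from the endpoints of the switch region, accumulation points can be pulled back. -/
lemma accPt_of_accPt_greedyMap (hQ : Q ∈ admissible) (hlt : switchLeft Q < switchRight Q)
    {W : Set ℝ} (hWV : W ⊆ survivor Q)
    (hW : ∀ y ∈ Set.Ico 0 (switchLeft Q) ∪ Set.Ioc (switchRight Q) (top Q),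
      greedyMap Q y ∈ W → y ∈ W) {x : ℝ} (hx : x ∈ survivor Q) (hL : x ≠ switchLeft Q)
    (hR : x ≠ switchRight Q) (h : AccPt (greedyMap Q x) (Filter.principal W)) :
    AccPt x (Filter.principal W) := by
  have hp := hQ.1
  have hq := hQ.2.1
  rw [accPt_principal_iff] at h ⊢
  intro ε hε
  rcases survivor_cases hx with hc | hc
  · have hxl := lt_of_le_of_ne hc.2 hL
    obtain ⟨y, hy, hne, hd⟩ := h (Q.1 * min ε (switchLeft Q - x))
      (mul_pos (by linarith) (lt_min hε (by linarith)))
    rw [greedyMap_of_le hc.2] at hne hd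
    have hd' : |y / Q.1 - x| < min ε (switchLeft Q - x) := by
      rw [← mul_lt_mul_iff_right₀ (by linarith : 0 < Q.1)]
      refine lt_of_eq_of_lt ?_ hd
      nth_rw 1 [← abs_of_pos (by linarith : 0 < Q.1)]
      rw [← abs_mul, mul_sub, mul_div_cancel₀ _ (by linarith)]
    rw [lt_min_iff] at hd'
    have hlt' : y / Q.1 < switchLeft Q := by linarith [le_abs_self (y / Q.1 - x)]
    refine ⟨y / Q.1, hW _ (.inl ⟨?_, hlt'⟩) ?_, fun he => hne ?_, hd'.1⟩
    · exact div_nonneg (survivor_subset hQ (hWV hy)).1 (by linarith)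
    · rwa [greedyMap_of_le hlt'.le, mul_div_cancel₀ _ (by linarith)]
    · rw [← he, mul_div_cancel₀ _ (by linarith)]
  · have hxl := lt_of_le_of_ne hc.1 hR.symm
    obtain ⟨y, hy, hne, hd⟩ := h (Q.2 * min ε (x - switchRight Q))
      (mul_pos (by linarith) (lt_min hε (by linarith)))
    rw [greedyMap_of_lt (by linarith)] at hne hd
    have hd' : |(y + 1) / Q.2 - x| < min ε (x - switchRight Q) := by
      rw [← mul_lt_mul_iff_right₀ (by linarith : 0 < Q.2)]
      refine lt_of_eq_of_lt ?_ hd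
      nth_rw 1 [← abs_of_pos (by linarith : 0 < Q.2)]
      rw [← abs_mul, mul_sub, mul_div_cancel₀ _ (by linarith), sub_sub_eq_add_sub]
    rw [lt_min_iff] at hd'
    have hlt' : switchRight Q < (y + 1) / Q.2 := by linarith [neg_abs_le ((y + 1) / Q.2 - x)]
    refine ⟨(y + 1) / Q.2, hW _ (.inr ⟨hlt', ?_⟩) ?_, fun he => hne ?_, hd'.1⟩
    · rw [div_le_iff₀' (by linarith), snd_mul_top hQ]
      linarith [(survivor_subset hQ (hWV hy)).2]
    · rwa [greedyMap_of_lt (by linarith), mul_div_cancel₀ _ (by linarith), add_sub_cancel_right]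
    · rw [← he, mul_div_cancel₀ _ (by linarith), add_sub_cancel_right]

lemma mem_survivor_of_mem_Ico_union (y : ℝ)
    (hy : y ∈ Set.Ico 0 (switchLeft Q) ∪ Set.Ioc (switchRight Q) (top Q))
    (h : greedyMap Q y ∈ survivor Q) : y ∈ survivor Q :=
  mem_survivor_of_greedyMap_mem (hy.imp (fun h => ⟨h.1, h.2.le⟩) fun h => ⟨h.1.le, h.2⟩) h

lemma mem_strictSurvivor_of_mem_Ico_union (y : ℝ)
    (hy : y ∈ Set.Ico 0 (switchLeft Q) ∪ Set.Ioc (switchRight Q) (top Q))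
    (h : greedyMap Q y ∈ strictSurvivor Q) : y ∈ strictSurvivor Q := fun n => by
  cases n with
  | zero => exact hy
  | succ n => exact h n

lemma closure_strictSurvivor_subset (hlt : switchLeft Q < switchRight Q) :
    closure (strictSurvivor Q) ⊆ survivor Q :=
  closure_minimal strictSurvivor_subset (isClosed_survivor hlt)

lemma greedyMap_iterate_mem_closure (hQ : Q ∈ admissible) (hlt : switchLeft Q < switchRight Q)
    {x : ℝ} (hx : x ∈ closure (strictSurvivor Q)) (n : ℕ) :
    (greedyMap Q)^[n] x ∈ closure (strictSurvivor Q) := by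
  induction n with
  | zero => exact hx
  | succ n ih =>
    rw [Function.iterate_succ_apply']
    rcases mem_closure_iff_mem_or_accPt.1 ih with h | h
    · exact subset_closure (greedyMap_iterate_mem_strictSurvivor h 1)
    · exact mem_closure_iff_mem_or_accPt.2 (.inr (accPt_greedyMap hQ hlt strictSurvivor_subset
        (fun y hy => greedyMap_iterate_mem_strictSurvivor hy 1)
        (closure_strictSurvivor_subset hlt ih) h))

lemma mem_closure_of_mem_hits (hQ : Q ∈ admissible) (hlt : switchLeft Q < switchRight Q)
    {a x : ℝ} (hx : x ∈ closure (strictSurvivor Q)) (h : x ∈ hits Q a) :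
    a ∈ closure (strictSurvivor Q) := by
  obtain ⟨n, rfl⟩ := h
  exact greedyMap_iterate_mem_closure hQ hlt hx n

/-- For a point that hits exactly one endpoint of the switch region, being an accumulation point
of an invariant set only depends on that endpoint. -/
lemma accPt_of_mem_hits (hQ : Q ∈ admissible) (hlt : switchLeft Q < switchRight Q) {W : Set ℝ}
    (hWV : W ⊆ survivor Q)
    (hW : ∀ y ∈ Set.Ico 0 (switchLeft Q) ∪ Set.Ioc (switchRight Q) (top Q),
      greedyMap Q y ∈ W → y ∈ W) {a b x : ℝ}
    (hab : AreEndpoints Q a b)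
    (hx : x ∈ survivor Q) (ha : x ∉ hits Q a) (hb : x ∈ hits Q b)
    (h : AccPt b (Filter.principal W)) : AccPt x (Filter.principal W) := by
  obtain ⟨n, hn⟩ := hb
  induction n generalizing x with
  | zero => rwa [show x = b from hn]
  | succ n ih =>
    -- The pullback stops at the first visit to b. Before that, the orbit meets neither endpoint and
    -- T is locally invertible along it.
    by_cases hxb : x = b
    · rwa [hxb]
    have hxa : x ≠ a := fun he => ha (he ▸ self_mem_hits x)
    have h1 := ih (greedyMap_mem_survivor hx) (fun h => ha (mem_hits_of_greedyMap_mem h)) hn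
    rcases hab with ⟨rfl, rfl⟩ | ⟨rfl, rfl⟩
    · exact accPt_of_accPt_greedyMap hQ hlt hWV hW hx hxa hxb h1
    · exact accPt_of_accPt_greedyMap hQ hlt hWV hW hx hxb hxa h1

lemma accPt_iterate (hQ : Q ∈ admissible) (hlt : switchLeft Q < switchRight Q) {x b : ℝ}
    (hx : x ∈ survivor Q) (hb : x ∈ hits Q b) (h : AccPt x (Filter.principal (survivor Q))) :
    AccPt b (Filter.principal (survivor Q)) := by
  obtain ⟨n, rfl⟩ := hb
  induction n with
  | zero => exact h
  | succ n ih =>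
    rw [Function.iterate_succ_apply']
    exact accPt_greedyMap hQ hlt le_rfl (fun y hy => greedyMap_mem_survivor hy)
      (greedyMap_iterate_mem_survivor hx n) ih

lemma accPt_of_mem_strictSurvivor
    (hd : survivor Q ⊆ closure (survivor Q \ strictSurvivor Q)) {x : ℝ}
    (hx : x ∈ strictSurvivor Q) :
    AccPt x (Filter.principal (survivor Q \ strictSurvivor Q)) :=
  (mem_closure_iff_mem_or_accPt.1 (hd (strictSurvivor_subset hx))).resolve_left fun h => h.2 hx

/-! ### Topology of the surviving sets -/

lemma AreEndpoints.right {a b : ℝ} (h : AreEndpoints Q a b) : IsEndpoint Q b :=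
  h.elim (fun h => .inr h.2) fun h => .inl h.2

lemma AreEndpoints.left {a b : ℝ} (h : AreEndpoints Q a b) : IsEndpoint Q a :=
  h.elim (fun h => .inl h.1) fun h => .inr h.1

lemma mem_hits_of_mem_diff (hQ : Q ∈ admissible) {a b x : ℝ} (hab : AreEndpoints Q a b)
    (hx : x ∈ survivor Q) (hU : x ∉ strictSurvivor Q) : x ∈ hits Q a ∨ x ∈ hits Q b := by
  have : x ∈ survivor Q \ strictSurvivor Q := ⟨hx, hU⟩
  rw [survivor_diff_strictSurvivor hQ] at this
  rcases hab with ⟨rfl, rfl⟩ | ⟨rfl, rfl⟩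
  · exact this.2
  · exact this.2.symm

lemma notMem_strictSurvivor_of_hits (hQ : Q ∈ admissible) {a x : ℝ} (ha : IsEndpoint Q a)
    (h : x ∈ hits Q a) : x ∉ strictSurvivor Q := fun hU => by
  rw [mem_strictSurvivor_iff hQ] at hU
  rcases ha with rfl | rfl
  · exact hU.2.1 h
  · exact hU.2.2 h

lemma mem_survivor_of_mem_hits {a x : ℝ} (hx : x ∈ survivor Q) (h : x ∈ hits Q a) :
    a ∈ survivor Q := by
  obtain ⟨n, rfl⟩ := h
  exact greedyMap_iterate_mem_survivor hx n

lemma interior_survivor (hQ : Q ∈ admissible) (hlt : switchLeft Q < switchRight Q) :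
    interior (survivor Q) = ∅ := by
  rw [Set.eq_empty_iff_forall_notMem]
  intro x hx
  rw [mem_interior_iff_mem_nhds, Metric.mem_nhds_iff] at hx
  obtain ⟨ε, hε, hball⟩ := hx
  have hsub : ∀ y, |y - x| < ε → y ∈ survivor Q := fun y hy => hball hy
  have h1 := survivor_subset hQ (hsub x (by simpa using hε))
  have h2 := survivor_subset hQ (hsub (x + ε / 2) (by
    rw [add_sub_cancel_left, abs_of_pos] <;> linarith))
  obtain ⟨y, hy, hyV⟩ := exists_notMem_survivor hQ hlt h1.1 (by linarith : x < x + ε / 2) h2.2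
  refine hyV (hsub y ?_)
  rw [abs_lt]
  constructor <;> linarith [hy.1, hy.2]

/-- A closed set without isolated points stays dense in itself after deleting the countable set 𝒱 \
𝒰. -/
lemma closure_eq_survivor_of_accPt (hQ : Q ∈ admissible) (hcl : IsClosed (survivor Q))
    (hacc : ∀ x ∈ survivor Q, AccPt x (Filter.principal (survivor Q))) :
    closure (strictSurvivor Q) = survivor Q := by
  refine (closure_minimal strictSurvivor_subset hcl).antisymm ?_
  have h := subset_closure_diff_of_countable hcl hacc (countable_survivor_diff hQ)
  rwa [sdiff_sdiff_eq_self strictSurvivor_subset] at h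

/-- Neither endpoint of the switch region hits the other one. -/
lemma survivor_of_not_hits (hQ : Q ∈ admissible) (hlt : switchLeft Q < switchRight Q)
    (hL : switchLeft Q ∈ survivor Q) (hR : switchRight Q ∈ survivor Q)
    (hLR : switchLeft Q ∉ hits Q (switchRight Q)) (hRL : switchRight Q ∉ hits Q (switchLeft Q)) :
    strictSurvivor Q ⊂ closure (strictSurvivor Q) ∧ closure (strictSurvivor Q) = survivor Q ∧
      IsCantorSet (survivor Q) := by
  have hacc : ∀ x ∈ survivor Q, AccPt x (Filter.principal (survivor Q)) := by
    intro x hx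
    by_cases h : x ∈ hits Q (switchLeft Q)
    · refine accPt_mono (accPt_hits_right hQ hlt hR hx fun h' => ?_) Set.inter_subset_left
      exact (mem_hits_or_mem_hits h h').elim hLR hRL
    · exact accPt_mono (accPt_hits_left hQ hlt hL hx h) Set.inter_subset_left
  have hcl := isClosed_survivor hlt
  have heq := closure_eq_survivor_of_accPt hQ hcl hacc
  refine ⟨⟨subset_closure, fun h => ?_⟩, heq, ⟨_, hL⟩,
    isCompact_Icc.of_isClosed_subset hcl (survivor_subset hQ), hacc, interior_survivor hQ hlt⟩
  rw [heq] at h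
  exact notMem_strictSurvivor_of_hits hQ (.inl rfl) (self_mem_hits _) (h hL)

/-- The closure of 𝒰 is T-invariant, so a limit point of 𝒰 outside 𝒰 would carry one of the
endpoints into that closure. -/
lemma isClosed_strictSurvivor_iff (hQ : Q ∈ admissible) (hlt : switchLeft Q < switchRight Q)
    {a b : ℝ} (hab : AreEndpoints Q a b) (ha : a ∉ closure (strictSurvivor Q)) :
    IsClosed (strictSurvivor Q) ↔ b ∉ closure (strictSurvivor Q) := by
  constructor
  · intro h
    rw [h.closure_eq]
    exact notMem_strictSurvivor_of_hits hQ hab.right (self_mem_hits b)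
  · intro hb
    refine closure_subset_iff_isClosed.1 fun x hx => ?_
    by_contra hU
    exact (mem_hits_of_mem_diff hQ hab (closure_strictSurvivor_subset hlt hx) hU).elim
      (fun h => ha (mem_closure_of_mem_hits hQ hlt hx h))
      fun h => hb (mem_closure_of_mem_hits hQ hlt hx h)

/-- Exactly one endpoint of the switch region hits the other one. -/
lemma survivor_of_one_hits (hQ : Q ∈ admissible) (hlt : switchLeft Q < switchRight Q) {a b : ℝ}
    (hab : AreEndpoints Q a b) (ha : a ∈ survivor Q) (hb : b ∈ survivor Q) (hh : a ∈ hits Q b)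
    (hn : b ∉ hits Q a) :
    (closure (strictSurvivor Q) ⊂ survivor Q ∧ ¬ IsCantorSet (survivor Q) ∧
      (IsDiscrete (survivor Q \ closure (strictSurvivor Q)) ↔ ¬ IsClosed (strictSurvivor Q))) ∧
    (IsClosed (strictSurvivor Q) ↔ b ∉ closure (strictSurvivor Q)) := by
  have hisol : ∀ x ∈ survivor Q, x ∈ hits Q a →
      ¬ AccPt x (Filter.principal (survivor Q)) := fun x hx h => by
    have h' := mem_hits_trans h hh
    rcases hab with ⟨rfl, rfl⟩ | ⟨rfl, rfl⟩
    · exact not_accPt_of_hits hQ hlt hx h h'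
    · exact not_accPt_of_hits hQ hlt hx h' h
  have haU := notMem_strictSurvivor_of_hits hQ hab.left (self_mem_hits a)
  have hbU := notMem_strictSurvivor_of_hits hQ hab.right (self_mem_hits b)
  have hacl : a ∉ closure (strictSurvivor Q) := fun h => by
    rcases mem_closure_iff_mem_or_accPt.1 h with h | h
    · exact haU h
    · exact hisol a ha (self_mem_hits a) (accPt_mono h strictSurvivor_subset)
  have hiff := isClosed_strictSurvivor_iff hQ hlt hab hacl
  refine ⟨⟨⟨closure_strictSurvivor_subset hlt, fun h => hacl (h ha)⟩,
    fun hC => hisol a ha (self_mem_hits a) (hC.2.2.1 a ha), ?_⟩, hiff⟩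
  rw [isDiscrete_iff_not_accPt]
  constructor
  · intro hd hcl
    rw [hcl.closure_eq] at hd
    -- Since b does not hit a, it is a limit of points of 𝒱 that do, and these are all outside 𝒰.
    refine hd b ⟨hb, hbU⟩ (accPt_mono (accPt_hits hQ hlt hab.left ha hb hn) ?_)
    exact fun y hy => ⟨hy.1, notMem_strictSurvivor_of_hits hQ hab.left hy.2⟩
  · intro hcl x hx hacc
    rw [hiff, not_not] at hcl
    have hbacc := (mem_closure_iff_mem_or_accPt.1 hcl).resolve_left hbU
    -- Points hitting a also hit b and are isolated. A point hitting only b inherits from b that it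
    -- is a limit of 𝒰, so none of these is outside the closure.
    by_cases hxa : x ∈ hits Q a
    · exact hisol x hx.1 hxa (accPt_mono hacc Set.sdiff_subset)
    · have hxb := (mem_hits_of_mem_diff hQ hab hx.1 fun h => hx.2 (subset_closure h)).resolve_left
        hxa
      exact hx.2 (mem_closure_iff_mem_or_accPt.2 (.inr (accPt_of_mem_hits hQ hlt
        strictSurvivor_subset mem_strictSurvivor_of_mem_Ico_union hab hx.1 hxa hxb hbacc)))

lemma isClosed_and_isDiscrete_of_isolated (hlt : switchLeft Q < switchRight Q)
    (h : ∀ x ∈ survivor Q \ strictSurvivor Q, ¬ AccPt x (Filter.principal (survivor Q))) :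
    IsClosed (strictSurvivor Q) ∧ IsDiscrete (survivor Q \ strictSurvivor Q) := by
  refine ⟨closure_subset_iff_isClosed.1 fun x hx => ?_, isDiscrete_iff_not_accPt.2
    fun x hx hacc => h x hx (accPt_mono hacc Set.sdiff_subset)⟩
  by_contra hU
  exact h x ⟨closure_strictSurvivor_subset hlt hx, hU⟩
    (accPt_mono ((mem_closure_iff_mem_or_accPt.1 hx).resolve_left hU) strictSurvivor_subset)

/-- The endpoints of the switch region hit each other. -/
lemma survivor_of_both_hit (hQ : Q ∈ admissible) (hlt : switchLeft Q < switchRight Q)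
    (hL : switchLeft Q ∈ survivor Q) (hLR : switchLeft Q ∈ hits Q (switchRight Q))
    (hRL : switchRight Q ∈ hits Q (switchLeft Q)) :
    IsClosed (strictSurvivor Q) ∧ IsDiscrete (survivor Q \ strictSurvivor Q) ∧
      ¬ IsCantorSet (survivor Q) := by
  obtain ⟨h1, h2⟩ := isClosed_and_isDiscrete_of_isolated hlt fun x hx => by
    rcases mem_hits_of_mem_diff hQ (.inl ⟨rfl, rfl⟩) hx.1 hx.2 with h | h
    · exact not_accPt_of_hits hQ hlt hx.1 h (mem_hits_trans h hLR)
    · exact not_accPt_of_hits hQ hlt hx.1 (mem_hits_trans h hRL) h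
  exact ⟨h1, h2, fun hC => not_accPt_of_hits hQ hlt hL (self_mem_hits _) hLR (hC.2.2.1 _ hL)⟩

/-- Exactly one endpoint of the switch region survives. -/
lemma survivor_of_one_survives (hQ : Q ∈ admissible) (hlt : switchLeft Q < switchRight Q)
    {a b : ℝ} (hab : AreEndpoints Q a b) (ha : a ∉ survivor Q) (hb : b ∈ survivor Q) :
    (strictSurvivor Q ⊂ survivor Q ∧
      (IsClosed (strictSurvivor Q) → (survivor Q \ strictSurvivor Q).Nonempty ∧
        IsDiscrete (survivor Q \ strictSurvivor Q)) ∧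
      (¬ IsClosed (strictSurvivor Q) → closure (strictSurvivor Q) = survivor Q)) ∧
    (IsClosed (strictSurvivor Q) ↔ b ∉ closure (strictSurvivor Q)) := by
  have hbU := notMem_strictSurvivor_of_hits hQ hab.right (self_mem_hits b)
  have hna : ∀ x ∈ survivor Q, x ∉ hits Q a := fun x hx h => ha (mem_survivor_of_mem_hits hx h)
  have hhb : ∀ x ∈ survivor Q \ strictSurvivor Q, x ∈ hits Q b := fun x hx =>
    (mem_hits_of_mem_diff hQ hab hx.1 hx.2).resolve_left (hna x hx.1)
  have hdense := subset_closure_survivor_diff hQ hlt hab.right hb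
  -- All of 𝒱 \ 𝒰 hits b and none of it hits a, so b decides the dichotomy: if b is a limit of 𝒱,
  -- then 𝒱 is perfect and 𝒰 dense in it; if b is isolated, so is every point of 𝒱 \ 𝒰.
  have hperf : AccPt b (Filter.principal (survivor Q)) →
      closure (strictSurvivor Q) = survivor Q := fun h =>
    closure_eq_survivor_of_accPt hQ (isClosed_survivor hlt) fun x hx => by
      by_cases hU : x ∈ strictSurvivor Q
      · exact accPt_mono (accPt_of_mem_strictSurvivor hdense hU) Set.sdiff_subset
      · exact accPt_of_mem_hits hQ hlt le_rfl mem_survivor_of_mem_Ico_union hab hx (hna x hx)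
          (hhb x ⟨hx, hU⟩) h
  have hisol : ¬ AccPt b (Filter.principal (survivor Q)) →
      IsClosed (strictSurvivor Q) ∧ IsDiscrete (survivor Q \ strictSurvivor Q) := fun h =>
    isClosed_and_isDiscrete_of_isolated hlt fun x hx hacc =>
      h (accPt_iterate hQ hlt hx.1 (hhb x hx) hacc)
  refine ⟨⟨⟨strictSurvivor_subset, fun h => hbU (h hb)⟩, fun hcl => ⟨⟨b, hb, hbU⟩, ?_⟩,
    fun hcl => ?_⟩,
    isClosed_strictSurvivor_iff hQ hlt hab fun h => ha (closure_strictSurvivor_subset hlt h)⟩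
  · refine (hisol fun h => hbU ?_).2
    have := hperf h
    rw [hcl.closure_eq] at this
    rwa [this]
  · by_contra hne
    exact hcl (hisol fun h => hne (hperf h)).1

lemma strictSurvivor_eq_of_notMem (hQ : Q ∈ admissible) (hL : switchLeft Q ∉ survivor Q)
    (hR : switchRight Q ∉ survivor Q) : strictSurvivor Q = survivor Q := by
  refine strictSurvivor_subset.antisymm fun x hx => ?_
  by_contra hU
  exact (mem_hits_of_mem_diff hQ (.inl ⟨rfl, rfl⟩) hx hU).elim
    (fun h => hL (mem_survivor_of_mem_hits hx h)) fun h => hR (mem_survivor_of_mem_hits hx h)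

/-! ### Double-bases on the curve `𝒞` -/

lemma closure_strictSurvivor_of_mem_curve (hQ : Q ∈ admissible) (hC : Q ∈ curve) :
    closure (strictSurvivor Q) = survivor Q := by
  have hV := survivor_of_mem_curve hQ hC
  refine closure_eq_survivor_of_accPt hQ (hV ▸ isClosed_Icc) fun x hx => ?_
  rw [hV] at hx ⊢
  have ht := top_pos hQ
  have hnt : (Set.Icc 0 (top Q)).Nontrivial :=
    ⟨0, ⟨le_rfl, ht.le⟩, top Q, ⟨ht.le, le_rfl⟩, ht.ne⟩
  exact isPreconnected_Icc.preperfect_of_nontrivial hnt x hx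

/-- The hole is now empty, so density comes from intervals expanding until they contain the single
point L = R. -/
lemma subset_closure_survivor_diff_of_mem_curve (hQ : Q ∈ admissible) (hC : Q ∈ curve) :
    survivor Q ⊆ closure (survivor Q \ strictSurvivor Q) := by
  intro x hx
  rw [survivor_of_mem_curve hQ hC, ← closure_Ioo (top_pos hQ).ne] at hx
  refine closure_minimal (fun y hy => ?_) isClosed_closure hx
  rw [Metric.mem_closure_iff]
  intro ε hε
  obtain ⟨z, ⟨hz1, hz2⟩, hz⟩ := exists_mem_hits_of_mem_curve hQ hC hy.1.le
    (lt_min hy.2 (by linarith : y < y + ε)) (min_le_left _ _)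
  rw [lt_min_iff] at hz2
  refine ⟨z, ⟨?_, notMem_strictSurvivor_of_hits hQ (.inl rfl) hz⟩, ?_⟩
  · rw [survivor_of_mem_curve hQ hC]
    exact ⟨by linarith [hy.1], hz2.1.le⟩
  · rw [Real.dist_eq, abs_sub_comm, abs_of_pos] <;> linarith [hz2.2]

lemma shift_eq_self_of_const {c : ℕ → Fin 2} {d : Fin 2} (h : ∀ n, c n = d) (i : ℕ) :
    shift i c = c := by
  ext n
  simp [shift, h]

lemma not_ltShifts_self_of_mem_curve (hQ : Q ∈ admissible) (hC : Q ∈ curve) :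
    ¬ LtShifts (mu Q) (mu Q) := fun h => by
  have := h 1 le_rfl
  rw [shift_eq_self_of_const (mu_of_mem_curve hQ hC)] at this
  exact lt_irrefl _ this

lemma not_shiftsLt_self_of_mem_curve (hQ : Q ∈ admissible) (hC : Q ∈ curve) :
    ¬ ShiftsLt (alpha Q) (alpha Q) := fun h => by
  have := h 1 le_rfl
  rw [shift_eq_self_of_const (alpha_of_mem_curve hQ hC)] at this
  exact lt_irrefl _ this

lemma mu_ne_alpha_of_mem_curve (hQ : Q ∈ admissible) (hC : Q ∈ curve) : mu Q ≠ alpha Q :=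
    fun h => by
  have h1 := congrFun h 0
  rw [mu_of_mem_curve hQ hC, alpha_of_mem_curve hQ hC] at h1
  exact absurd h1 (by decide)

lemma notMem_curve_of_leShifts (hQ : Q ∈ admissible) (h : LeShifts (mu Q) (alpha Q)) :
    Q ∉ curve := fun hC => by
  obtain ⟨-, i, -, hi⟩ := h
  rw [shift_eq_self_of_const (alpha_of_mem_curve hQ hC)] at hi
  exact mu_ne_alpha_of_mem_curve hQ hC hi

lemma notMem_curve_of_shiftsLe (hQ : Q ∈ admissible) (h : ShiftsLe (mu Q) (alpha Q)) :
    Q ∉ curve := fun hC => by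
  obtain ⟨-, i, -, hi⟩ := h
  rw [shift_eq_self_of_const (mu_of_mem_curve hQ hC)] at hi
  exact mu_ne_alpha_of_mem_curve hQ hC hi

lemma notMem_curve_of_exceedsAlpha (hQ : Q ∈ admissible) (h : ExceedsAlpha (mu Q) (alpha Q)) :
    Q ∉ curve := fun hC => by
  obtain ⟨i, -, hi⟩ := h
  exact (lex_le_of_one (alpha_of_mem_curve hQ hC)).not_gt hi

lemma notMem_curve_of_fallsBelowMu (hQ : Q ∈ admissible) (h : FallsBelowMu (mu Q) (alpha Q)) :
    Q ∉ curve := fun hC => by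
  obtain ⟨i, -, hi⟩ := h
  exact (lex_le_of_zero (mu_of_mem_curve hQ hC)).not_gt hi

/-! ### The endpoints of the switch region in terms of `α` and `μ` -/

lemma switchLeft_mem_survivor_of_ltShifts (hQ : Q ∈ admissible)
    (h : LtShifts (mu Q) (alpha Q)) : switchLeft Q ∈ survivor Q :=
  (switchLeft_mem_survivor_iff hQ).2 (not_fallsBelowMu_of_le fun i hi => (h i hi).le)

lemma switchLeft_mem_survivor_of_leShifts (hQ : Q ∈ admissible)
    (h : LeShifts (mu Q) (alpha Q)) : switchLeft Q ∈ survivor Q :=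
  (switchLeft_mem_survivor_iff hQ).2 (not_fallsBelowMu_of_le h.1)

lemma switchRight_mem_survivor_of_shiftsLt (hQ : Q ∈ admissible)
    (hlt : switchLeft Q < switchRight Q) (h : ShiftsLt (mu Q) (alpha Q)) :
    switchRight Q ∈ survivor Q :=
  (switchRight_mem_survivor_iff hQ hlt).2 (not_exceedsAlpha_of_le fun i hi => (h i hi).le)

lemma switchRight_mem_survivor_of_shiftsLe (hQ : Q ∈ admissible)
    (hlt : switchLeft Q < switchRight Q) (h : ShiftsLe (mu Q) (alpha Q)) :
    switchRight Q ∈ survivor Q :=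
  (switchRight_mem_survivor_iff hQ hlt).2 (not_exceedsAlpha_of_le h.1)

lemma survivor_of_leShifts_of_shiftsLt (hQ : Q ∈ admissible) (h1 : LeShifts (mu Q) (alpha Q))
    (h2 : ShiftsLt (mu Q) (alpha Q)) :
    (closure (strictSurvivor Q) ⊂ survivor Q ∧ ¬ IsCantorSet (survivor Q) ∧
      (IsDiscrete (survivor Q \ closure (strictSurvivor Q)) ↔ ¬ IsClosed (strictSurvivor Q))) ∧
    (IsClosed (strictSurvivor Q) ↔ switchRight Q ∉ closure (strictSurvivor Q)) := by
  have hlt := switchLeft_lt_switchRight hQ (notMem_curve_of_leShifts hQ h1)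
  exact survivor_of_one_hits hQ hlt (.inl ⟨rfl, rfl⟩) (switchLeft_mem_survivor_of_leShifts hQ h1)
    (switchRight_mem_survivor_of_shiftsLt hQ hlt h2) (switchLeft_mem_hits hQ hlt h1)
    (switchRight_notMem_hits hQ hlt h2)

lemma survivor_of_ltShifts_of_shiftsLe (hQ : Q ∈ admissible) (h1 : LtShifts (mu Q) (alpha Q))
    (h2 : ShiftsLe (mu Q) (alpha Q)) :
    (closure (strictSurvivor Q) ⊂ survivor Q ∧ ¬ IsCantorSet (survivor Q) ∧
      (IsDiscrete (survivor Q \ closure (strictSurvivor Q)) ↔ ¬ IsClosed (strictSurvivor Q))) ∧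
    (IsClosed (strictSurvivor Q) ↔ switchLeft Q ∉ closure (strictSurvivor Q)) := by
  have hlt := switchLeft_lt_switchRight hQ (notMem_curve_of_shiftsLe hQ h2)
  exact survivor_of_one_hits hQ hlt (.inr ⟨rfl, rfl⟩)
    (switchRight_mem_survivor_of_shiftsLe hQ hlt h2) (switchLeft_mem_survivor_of_ltShifts hQ h1)
    (switchRight_mem_hits hQ hlt h2) (switchLeft_notMem_hits hQ hlt h1)

lemma survivor_of_shiftsLt_of_fallsBelowMu (hQ : Q ∈ admissible)
    (h1 : ShiftsLt (mu Q) (alpha Q)) (h2 : FallsBelowMu (mu Q) (alpha Q)) :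
    (strictSurvivor Q ⊂ survivor Q ∧
      (IsClosed (strictSurvivor Q) → (survivor Q \ strictSurvivor Q).Nonempty ∧
        IsDiscrete (survivor Q \ strictSurvivor Q)) ∧
      (¬ IsClosed (strictSurvivor Q) → closure (strictSurvivor Q) = survivor Q)) ∧
    (IsClosed (strictSurvivor Q) ↔ switchRight Q ∉ closure (strictSurvivor Q)) := by
  have hlt := switchLeft_lt_switchRight hQ (notMem_curve_of_fallsBelowMu hQ h2)
  exact survivor_of_one_survives hQ hlt (.inl ⟨rfl, rfl⟩)
    (fun h => (switchLeft_mem_survivor_iff hQ).1 h h2)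
    (switchRight_mem_survivor_of_shiftsLt hQ hlt h1)

lemma survivor_of_exceedsAlpha_of_ltShifts (hQ : Q ∈ admissible)
    (h1 : ExceedsAlpha (mu Q) (alpha Q)) (h2 : LtShifts (mu Q) (alpha Q)) :
    (strictSurvivor Q ⊂ survivor Q ∧
      (IsClosed (strictSurvivor Q) → (survivor Q \ strictSurvivor Q).Nonempty ∧
        IsDiscrete (survivor Q \ strictSurvivor Q)) ∧
      (¬ IsClosed (strictSurvivor Q) → closure (strictSurvivor Q) = survivor Q)) ∧
    (IsClosed (strictSurvivor Q) ↔ switchLeft Q ∉ closure (strictSurvivor Q)) := by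
  have hlt := switchLeft_lt_switchRight hQ (notMem_curve_of_exceedsAlpha hQ h1)
  exact survivor_of_one_survives hQ hlt (.inr ⟨rfl, rfl⟩)
    (fun h => (switchRight_mem_survivor_iff hQ hlt).1 h h1)
    (switchLeft_mem_survivor_of_ltShifts hQ h2)

/-- Each alternative makes an endpoint survive. The curve needs separate treatment because case 8
does not exclude it. -/
lemma subset_closure_survivor_diff_of_shifts (hQ : Q ∈ admissible)
    (h : LtShifts (mu Q) (alpha Q) ∨ LeShifts (mu Q) (alpha Q) ∨ ShiftsLt (mu Q) (alpha Q)) :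
    survivor Q ⊆ closure (survivor Q \ strictSurvivor Q) := by
  by_cases hC : Q ∈ curve
  · exact subset_closure_survivor_diff_of_mem_curve hQ hC
  have hlt := switchLeft_lt_switchRight hQ hC
  rcases h with h | h | h
  · exact subset_closure_survivor_diff hQ hlt (.inl rfl) (switchLeft_mem_survivor_of_ltShifts hQ h)
  · exact subset_closure_survivor_diff hQ hlt (.inl rfl) (switchLeft_mem_survivor_of_leShifts hQ h)
  · exact subset_closure_survivor_diff hQ hlt (.inr rfl)
      (switchRight_mem_survivor_of_shiftsLt hQ hlt h)

end DoubleBase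

/-! ### The theorem, case by case. -/

open DoubleBase in
theorem theorem1p15 (Q : ℝ × ℝ) (hQ : Q ∈ admissible) :
    -- (i)
    (IsClosed (weakUnivoque Q) ∧ univoque Q ⊆ closure (univoque Q) ∧
      closure (univoque Q) ⊆ weakUnivoque Q) ∧
    -- (ii)
    ((Case1 (mu Q) (alpha Q) ∨ Case2 (mu Q) (alpha Q) ∨ Case3 (mu Q) (alpha Q) ∨
        Case4 (mu Q) (alpha Q) ∨ Case5 (mu Q) (alpha Q) ∨ Case6 (mu Q) (alpha Q) ∨
        Case7 (mu Q) (alpha Q) ∨ Case8 (mu Q) (alpha Q) ∨ Case9 (mu Q) (alpha Q) ∨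
        Case10 (mu Q) (alpha Q) ∨ Case11 (mu Q) (alpha Q)) →
      Cardinal.mk ↥(weakUnivoque Q \ univoque Q) = Cardinal.aleph0 ∧
        weakUnivoque Q ⊆ closure (weakUnivoque Q \ univoque Q)) ∧
    -- (iii)
    (Case9 (mu Q) (alpha Q) →
      IsClosed (univoque Q) ∧ IsDiscrete (weakUnivoque Q \ univoque Q) ∧
        ¬ IsCantorSet (weakUnivoque Q)) ∧
    -- (iv)
    (Q ∈ curve →
      closure (univoque Q) = weakUnivoque Q ∧ weakUnivoque Q = interval Q) ∧
    -- (v)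
    ((Case1 (mu Q) (alpha Q) ∨ Case4 (mu Q) (alpha Q) ∨ Case5 (mu Q) (alpha Q) ∨
        (Case8 (mu Q) (alpha Q) ∧ Q ∉ curve)) →
      univoque Q ⊂ closure (univoque Q) ∧ closure (univoque Q) = weakUnivoque Q ∧
        IsCantorSet (weakUnivoque Q)) ∧
    -- (vi)
    ((Case2 (mu Q) (alpha Q) ∨ Case3 (mu Q) (alpha Q) ∨ Case6 (mu Q) (alpha Q) ∨
        Case7 (mu Q) (alpha Q)) →
      closure (univoque Q) ⊂ weakUnivoque Q ∧ ¬ IsCantorSet (weakUnivoque Q) ∧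
        (IsDiscrete (weakUnivoque Q \ closure (univoque Q)) ↔ ¬ IsClosed (univoque Q))) ∧
    ((Case2 (mu Q) (alpha Q) ∨ Case7 (mu Q) (alpha Q)) →
      (IsClosed (univoque Q) ↔ 1 / (Q.1 * (Q.2 - 1)) ∉ closure (univoque Q))) ∧
    ((Case3 (mu Q) (alpha Q) ∨ Case6 (mu Q) (alpha Q)) →
      (IsClosed (univoque Q) ↔ 1 / Q.2 ∉ closure (univoque Q))) ∧
    -- (vii)
    ((Case10 (mu Q) (alpha Q) ∨ Case11 (mu Q) (alpha Q)) →
      univoque Q ⊂ weakUnivoque Q ∧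
        (IsClosed (univoque Q) →
          (weakUnivoque Q \ univoque Q).Nonempty ∧ IsDiscrete (weakUnivoque Q \ univoque Q)) ∧
        (¬ IsClosed (univoque Q) → closure (univoque Q) = weakUnivoque Q)) ∧
    (Case11 (mu Q) (alpha Q) →
      (IsClosed (univoque Q) ↔ 1 / (Q.1 * (Q.2 - 1)) ∉ closure (univoque Q))) ∧
    (Case10 (mu Q) (alpha Q) →
      (IsClosed (univoque Q) ↔ 1 / Q.2 ∉ closure (univoque Q))) ∧
    -- (viii)
    (Case12 (mu Q) (alpha Q) →
      univoque Q = closure (univoque Q) ∧ closure (univoque Q) = weakUnivoque Q) := by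
  rw [weakUnivoque_eq hQ, univoque_eq hQ]
  have hcl : IsClosed (survivor Q) := by
    by_cases hC : Q ∈ curve
    · rw [survivor_of_mem_curve hQ hC]
      exact isClosed_Icc
    · exact isClosed_survivor (switchLeft_lt_switchRight hQ hC)
  refine ⟨⟨hcl, subset_closure, closure_minimal strictSurvivor_subset hcl⟩,
    fun h => ?_, fun h => ?_,
    fun hC => ⟨closure_strictSurvivor_of_mem_curve hQ hC, survivor_of_mem_curve hQ hC⟩,
    fun h => ?_, fun h => ?_, fun h => ?_, fun h => ?_, fun h => ?_,
    fun h => (survivor_of_shiftsLt_of_fallsBelowMu hQ h.1 h.2).2,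
    fun h => (survivor_of_exceedsAlpha_of_ltShifts hQ h.1 h.2).2, fun h => ?_⟩
  · have hd := subset_closure_survivor_diff_of_shifts hQ (by
      rcases h with h | h | h | h | h | h | h | h | h | h | h
      · exact .inl h.2.2.1
      · exact .inr (.inl h.2.2.1)
      · exact .inl h.2.2.1
      · exact .inl h.2.2.1
      · exact .inl h.2.2.1
      · exact .inl h.2.2.1
      · exact .inr (.inl h.2.2.1)
      · exact .inl h.2.2.1
      · exact .inr (.inl h.2.2.1)
      · exact .inl h.2
      · exact .inr (.inr h.1))
    exact ⟨mk_survivor_diff hQ hd, hd⟩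
  · obtain ⟨-, h1, h2, -⟩ := h
    have hlt := switchLeft_lt_switchRight hQ (notMem_curve_of_leShifts hQ h2)
    exact survivor_of_both_hit hQ hlt (switchLeft_mem_survivor_of_leShifts hQ h2)
      (switchLeft_mem_hits hQ hlt h2) (switchRight_mem_hits hQ hlt h1)
  -- On the curve μ = 0^∞ and α = 1^∞ equal their own shifts, so the strict self-comparisons in
  -- cases 1, 4 and 5 exclude it.
  · have key : ShiftsLt (mu Q) (alpha Q) ∧ LtShifts (mu Q) (alpha Q) ∧ Q ∉ curve := by
      rcases h with h | h | h | ⟨h, hC⟩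
      · exact ⟨h.2.1, h.2.2.1, fun hC => not_ltShifts_self_of_mem_curve hQ hC h.1⟩
      · exact ⟨h.2.1, h.2.2.1, fun hC => not_ltShifts_self_of_mem_curve hQ hC h.1⟩
      · exact ⟨h.2.1, h.2.2.1, fun hC => not_shiftsLt_self_of_mem_curve hQ hC h.2.2.2⟩
      · exact ⟨h.2.1, h.2.2.1, hC⟩
    obtain ⟨h1, h2, hC⟩ := key
    have hlt := switchLeft_lt_switchRight hQ hC
    exact survivor_of_not_hits hQ hlt (switchLeft_mem_survivor_of_ltShifts hQ h2)
      (switchRight_mem_survivor_of_shiftsLt hQ hlt h1) (switchLeft_notMem_hits hQ hlt h2)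
      (switchRight_notMem_hits hQ hlt h1)
  · rcases h with h | h | h | h
    · exact (survivor_of_leShifts_of_shiftsLt hQ h.2.2.1 h.2.1).1
    · exact (survivor_of_ltShifts_of_shiftsLe hQ h.2.2.1 h.2.1).1
    · exact (survivor_of_ltShifts_of_shiftsLe hQ h.2.2.1 h.2.1).1
    · exact (survivor_of_leShifts_of_shiftsLt hQ h.2.2.1 h.2.1).1
  · rcases h with h | h
    · exact (survivor_of_leShifts_of_shiftsLt hQ h.2.2.1 h.2.1).2
    · exact (survivor_of_leShifts_of_shiftsLt hQ h.2.2.1 h.2.1).2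
  · rcases h with h | h
    · exact (survivor_of_ltShifts_of_shiftsLe hQ h.2.2.1 h.2.1).2
    · exact (survivor_of_ltShifts_of_shiftsLe hQ h.2.2.1 h.2.1).2
  · rcases h with h | h
    · exact (survivor_of_exceedsAlpha_of_ltShifts hQ h.1 h.2).1
    · exact (survivor_of_shiftsLt_of_fallsBelowMu hQ h.1 h.2).1
  · have hlt := switchLeft_lt_switchRight hQ (notMem_curve_of_exceedsAlpha hQ h.1)
    have he := strictSurvivor_eq_of_notMem hQ (fun h' => (switchLeft_mem_survivor_iff hQ).1 h' h.2)
      fun h' => (switchRight_mem_survivor_iff hQ hlt).1 h' h.1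
    rw [he, hcl.closure_eq]
    exact ⟨rfl, rfl⟩
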